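/- Work in the Clifford (geometric) algebra $Cl_n$ of Euclidean space $\mathbb R^n$, with $\widetilde{X}$ the reverse of $X$, $\langle X\rangle_k$ the grade-$k$ part and $|X|=\sqrt{\langle X\widetilde X\rangle_0}$. A normed $k$-blade is an outer product of $k$ vectors of magnitude $1$; a blade $D$ represents the subspace $\{x\in\mathbb R^n: x\wedge D=0\}$. Let $q,r\ge 0$, let $A$ be a normed $(r+q)$-blade and $B$ a normed $r$-blade, and let $A=A_1A_2$ with a normed $q$-blade $A_1$ and a normed $r$-blade $A_2$, where $A_1\perp A_2$ and $A_1\perp B$ (that is, every vector $x$ with $x\rfloor A_1=xA_1$ satisfies $x\rfloor A_2=x\rfloor B=0$). Let $\mathsf A,\mathsf A_2,\mathsf B$ be the subspaces of $A,A_2,B$. Principal vectors for $(\mathsf A_2,\mathsf B)$ are orthonormal bases $a_1,\dots,a_r$ of $\mathsf A_2$ and $b_1,\dots,b_r$ of $\mathsf B$ with $a_k\cdot b_l=0$ for $k\ne l$ and $a_k\cdot b_k\ge 0$; the principal angles are $\theta_k=\angle(a_k,b_k)\in[0,\pi/2]$. Write $c_k=\cos\theta_k$, $s_k=\sin\theta_k$,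 and $\mathbf i_k=(a_k\wedge b_k)/s_k$ when $\theta_k\neq 0$. Let $Z,M,P$ be the sets of indices $k$ with $\theta_k=0$, $0<\theta_k<\pi/2$, $\theta_k=\pi/2$ respectively, $s=|Z|$, $t=|P|$, and $\mathbf i_S=\prod_{k\in S}\mathbf i_k$ (factors in increasing order of $k$). (If the angles are listed increasingly, then $Z=\{1,\dots,s\}$, $M=\{s+1,\dots,r-t\}$, $P=\{r-t+1,\dots,r\}$.) Principal vectors exist, and for every choice of them the following holds. 1. There is a sign $\varepsilon\in\{1,-1\}$ with $$A\widetilde B=\varepsilon\,A_1\Big(\sum_{S\subseteq M}\ \prod_{k\in S}s_k\prod_{k\in M\setminus S}c_k\ \mathbf i_S\Big)\,\mathbf i_P .$$ If $\langle A_2\widetilde B\rangle_0\ge 0$, the principal vectors can be chosen such that this holds with $\varepsilon=1$. 2. $s=\dim(\mathsf A\cap\mathsf B)$, and $t$ is independent of the choice of the factorization: for any other factorization $A=A_1'A_2'$ as above and any principal vectors for $(\mathsf A_2',\mathsf B)$, the number of principal angles $\pi/2$ is again $t$. 3. The lowest non-zero grade part of $A\widetilde B$ has grade $2t+q$; it is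 $L=\varepsilon\,\big(\prod_{k\in M}c_k\big)A_1\mathbf i_P$, with the $\varepsilon$ of part 1, and has magnitude $\cos\theta_{\mathsf A\mathsf B}:=\prod_{k\in M}c_k$. 4. The highest non-zero grade part of $A\widetilde B$ has grade $2(r-s)+q$ and magnitude $\prod_{k\in M}s_k$. 5. $L$ is invertible and $W:=A\widetilde B\,L^{-1}=L^{-1}A\widetilde B$ has scalar part $1$, maximal non-zero grade $2(r-t-s)$, and bivector part $$F=\langle W\rangle_2=\sum_{k\in M}\tan\theta_k\ \mathbf i_k .$$ From $F$ the principal angles $\theta_k$, $k\in M$, are read off: the sum above is a splitting of $F$ into positive multiples of unit $2$-blades in mutually orthogonal planes, and for any such splitting $F=\sum_j\tau_jJ_j$ (with $\tau_j>0$ and $J_j=u_j\wedge v_j$, all the $u_j,v_j$ together orthonormal) the multiset of the numbers $\arctan\tau_j$ equals the multiset of the $\theta_k$, $k\in M$. -/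

import Mathlib

open scoped RealInnerProductSpace

noncomputable section

namespace SubspaceAngles

/-- Euclidean space of dimension `n`. -/
abbrev V (n : ℕ) : Type := EuclideanSpace ℝ (Fin n)

/-- The Euclidean quadratic form `x ↦ ⟪x, x⟫`. -/
abbrev Q (n : ℕ) : QuadraticForm ℝ (V n) := LinearMap.BilinMap.toQuadraticMap (innerₗ (V n))

/-- The Clifford (geometric) algebra of Euclidean `n`-space; its product is the geometric
product. -/
abbrev Cl (n : ℕ) : Type := CliffordAlgebra (Q n)

instance invertibleTwo : Invertible (2 : ℝ) := invertibleOfNonzero two_ne_zero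

variable {n : ℕ}

/-- The canonical linear identification of the Clifford algebra with the Grassmann algebra
(a product of mutually orthogonal vectors corresponds to their outer product). -/
def toGrassmann (n : ℕ) : Cl n ≃ₗ[ℝ] ExteriorAlgebra ℝ (V n) :=
  CliffordAlgebra.equivExterior (Q n)

/-- The grade-`k` part `⟨X⟩ₖ` of a multivector. -/
def gradePart (k : ℕ) (X : Cl n) : Cl n :=
  (toGrassmann n).symm
    (GradedAlgebra.proj (fun i : ℕ => ⋀[ℝ]^i (V n)) k (toGrassmann n X))

/-- The scalar part `⟨X⟩₀`, as a real number. -/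
def scalarPart (X : Cl n) : ℝ := ExteriorAlgebra.algebraMapInv (toGrassmann n X)

/-- The magnitude of a multivector, `|X|² = ⟨X X̃⟩₀`. -/
def magnitude (X : Cl n) : ℝ := Real.sqrt (scalarPart (X * CliffordAlgebra.reverse X))

/-- The outer product `v₁ ∧ ⋯ ∧ vᵣ` of vectors, as an element of the Clifford algebra. -/
def outer {r : ℕ} (v : Fin r → V n) : Cl n :=
  (toGrassmann n).symm (ExteriorAlgebra.ιMulti ℝ r v)

/-- `X` is a normed `r`-blade: an outer product of `r` vectors, of magnitude one. -/
def IsNormedBlade (r : ℕ) (X : Cl n) : Prop :=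
  (∃ v : Fin r → V n, X = outer v) ∧ magnitude X = 1

/-- The subspace `{x | x ∧ X = 0}` represented by a blade `X`. -/
def bladeSpace (X : Cl n) : Submodule ℝ (V n) where
  carrier := {x | ExteriorAlgebra.ι ℝ x * toGrassmann n X = 0}
  add_mem' := by
    intro x y hx hy
    simp only [Set.mem_ofPred_eq] at hx hy ⊢
    rw [map_add, add_mul, hx, hy, add_zero]
  zero_mem' := by simp
  smul_mem' := by
    intro c x hx
    simp only [Set.mem_ofPred_eq] at hx ⊢
    rw [map_smul, smul_mul_assoc, hx, smul_zero]

/-- The left contraction `x ⌋ X` of a multivector by a vector. -/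
def contract (x : V n) (X : Cl n) : Cl n :=
  CliffordAlgebra.contractLeft (innerₗ (V n) x) X

/-- Orthogonality of blades, `X ⊥ Y`: every vector `x` with `x ⌋ X = x X` has `x ⌋ Y = 0`. -/
def BladeOrthogonal (X Y : Cl n) : Prop :=
  ∀ x : V n, contract x X = CliffordAlgebra.ι (Q n) x * X → contract x Y = 0

/-- `A = A₁ A₂` with normed blades `A₁` of grade `q` and `A₂` of grade `r`, where `A₁` is
orthogonal to both `A₂` and `B`. -/
structure IsFactorization (q r : ℕ) (A B A₁ A₂ : Cl n) : Prop where
  normed_left : IsNormedBlade q A₁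
  normed_right : IsNormedBlade r A₂
  eq_mul : A = A₁ * A₂
  orth_right : BladeOrthogonal A₁ A₂
  orth_blade : BladeOrthogonal A₁ B

/-- `a`, `b` are principal vectors of the `r`-dimensional subspaces `U`, `W`: orthonormal bases
such that the pairs `aₖ, bₖ` span mutually orthogonal lines or planes and enclose an angle
of at most `π / 2`. -/
structure IsPrincipalSystem {r : ℕ} (U W : Submodule ℝ (V n)) (a b : Fin r → V n) : Prop where
  orthonormal_left : Orthonormal ℝ a
  orthonormal_right : Orthonormal ℝ b
  span_left : Submodule.span ℝ (Set.range a) = U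
  span_right : Submodule.span ℝ (Set.range b) = W
  inner_ne : ∀ k l, k ≠ l → ⟪a k, b l⟫ = 0
  inner_nonneg : ∀ k, 0 ≤ ⟪a k, b k⟫

/-- The principal angle `θₖ` between `aₖ` and `bₖ`. -/
def ang {r : ℕ} (a b : Fin r → V n) (k : Fin r) : ℝ := InnerProductGeometry.angle (a k) (b k)

/-- The unit bivector `𝐢ₖ = (aₖ ∧ bₖ) / sin θₖ` of the `k`-th principal plane; it is used only
for `θₖ ≠ 0`. -/
def planeBivector {r : ℕ} (a b : Fin r → V n) (k : Fin r) : Cl n :=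
  (Real.sin (ang a b k))⁻¹ • outer ![a k, b k]

open Classical in
/-- Indices of vanishing principal angles (`k ≤ s` in increasing order of the angles). -/
def parIdx {r : ℕ} (a b : Fin r → V n) : Finset (Fin r) :=
  Finset.univ.filter fun k => ang a b k = 0

open Classical in
/-- Indices of principal angles `π / 2` (`r - t < k` in increasing order of the angles). -/
def perpIdx {r : ℕ} (a b : Fin r → V n) : Finset (Fin r) :=
  Finset.univ.filter fun k => ang a b k = Real.pi / 2

open Classical in
/-- Indices of the other principal angles (`s < k ≤ r - t` in increasing order). -/
def midIdx {r : ℕ} (a b : Fin r → V n) : Finset (Fin r) :=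
  Finset.univ.filter fun k => 0 < ang a b k ∧ ang a b k < Real.pi / 2

/-- The geometric product of the unit bivectors `𝐢ₖ`, `k ∈ S`, in increasing order of `k`. -/
def planeProd {r : ℕ} (a b : Fin r → V n) (S : Finset (Fin r)) : Cl n :=
  ((S.sort (· ≤ ·)).map (planeBivector a b)).prod

/-- The expanded product of rotors
`(c ⋯ c + s c ⋯ c 𝐢 + ⋯ + s ⋯ s 𝐢 ⋯ 𝐢)` over the principal angles strictly between `0` and
`π / 2`, times the product of the unit bivectors of the principal angles `π / 2`: the term of
`S` has a sine and a bivector for each index in `S`, and a cosine for each other index. -/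
def rotorSum {r : ℕ} (a b : Fin r → V n) : Cl n :=
  (∑ S ∈ (midIdx a b).powerset,
    ((∏ k ∈ S, Real.sin (ang a b k)) * ∏ k ∈ midIdx a b \ S, Real.cos (ang a b k)) •
      planeProd a b S) * planeProd a b (perpIdx a b)

/-- `F = ∑ⱼ τⱼ Jⱼ` splits the bivector `F` into positive multiples of unit 2-blades `Jⱼ` in
mutually orthogonal planes. -/
def IsSplitting {κ : Type} [Fintype κ] (F : Cl n) (τ : κ → ℝ) (J : κ → Cl n) : Prop :=
  (∃ u v : κ → V n, Orthonormal ℝ (Sum.elim u v) ∧ ∀ j, J j = outer ![u j, v j]) ∧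
    (∀ j, 0 < τ j) ∧ F = ∑ j, τ j • J j

end SubspaceAngles

end

open scoped RealInnerProductSpace

noncomputable section

namespace SubspaceAngles

variable {n : ℕ}

open CliffordAlgebra

-- The outer product of orthonormal vectors is their geometric product (`outer_orthonormal`), so
-- every normed blade is, up to sign, a product of any orthonormal basis of its subspace
-- (`IsNormedBlade.eq_smul_vecProd`). With principal vectors this makes `A₂` and `B` equal to
-- `±a₁⋯aᵣ` and `±b₁⋯bᵣ`. In `a₁⋯aᵣbᵣ⋯b₁` the innermost pair is `cᵣ + sᵣ𝐢ᵣ`, which commutes with the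
-- vectors of all other principal planes. Working outwards, the product becomes `∏ (cₖ + sₖ𝐢ₖ)` with
-- commuting factors (`vecProd_mul_reverse_eq_rotorSum`). The factor is `1` on `Z` and `𝐢ₖ` on `P`;
-- expanding the factors of `M` gives the sum over `S ⊆ M`.
--
-- Since `𝐢ₖ = aₖnₖ` with orthonormal `aₖ, nₖ`, the term of `S` is a multiple of a product of `q +
-- 2t + 2|S|` orthonormal vectors, hence homogeneous of that grade (`IsBladeFamily`). The extreme
-- grades come from `S = ∅` and `S = M` alone. The lowest grade depends only on `AB̃`, so `t` does
-- not depend on the factorization. Pulling out the cosines gives `AB̃ = LR` with `R = ∑ (∏ tan θₖ)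
-- 𝐢_S`; as `R` commutes with `L`, it is the quotient on both sides.
--
-- A bivector `F = ∑ τⱼ uⱼ∧vⱼ` acts on vectors by `x ↦ x⌋F`, a quarter turn scaled by `τⱼ` in each
-- plane. Minus its square has eigenvalue `τⱼ²` on that plane, so eigenspace dimensions recover the
-- `τⱼ` from `F` (`IsSplitting.multiset_eq`).

/-- The geometric product of a list of vectors. -/
def vecProd (l : List (V n)) : Cl n := (l.map (ι (Q n))).prod

@[simp] lemma vecProd_nil : vecProd ([] : List (V n)) = 1 := rfl

@[simp] lemma vecProd_cons (x : V n) (l : List (V n)) :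
    vecProd (x :: l) = ι (Q n) x * vecProd l := by simp [vecProd]

@[simp] lemma vecProd_append (l l' : List (V n)) :
    vecProd (l ++ l') = vecProd l * vecProd l' := by simp [vecProd]

-- Clifford relations, contraction and passage to the Grassmann algebra

lemma ι_mul_self (x : V n) : ι (Q n) x * ι (Q n) x = algebraMap ℝ _ ⟪x, x⟫ := by
  rw [ι_sq_scalar]; rfl

lemma ι_mul_add_swap (x y : V n) :
    ι (Q n) x * ι (Q n) y + ι (Q n) y * ι (Q n) x = algebraMap ℝ _ (2 * ⟪x, y⟫) := by
  rw [ι_mul_ι_add_swap]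
  congr 1
  simp only [QuadraticMap.polar, LinearMap.BilinMap.toQuadraticMap_apply, innerₗ_apply_apply,
    inner_add_left, inner_add_right, real_inner_comm x y]
  ring

lemma ι_mul_swap (x y : V n) (h : ⟪x, y⟫ = 0) :
    ι (Q n) x * ι (Q n) y = - (ι (Q n) y * ι (Q n) x) := by
  have := ι_mul_add_swap x y
  rw [h, mul_zero, map_zero] at this
  exact eq_neg_of_add_eq_zero_left this

lemma contract_ι_mul (x y : V n) (X : Cl n) :
    contract x (ι (Q n) y * X) = ⟪x, y⟫ • X - ι (Q n) y * contract x X := by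
  simp [contract, contractLeft_ι_mul]

lemma contract_one (x : V n) : contract x (1 : Cl n) = 0 := contractLeft_one (Q := Q n) _

lemma contract_smul (x : V n) (c : ℝ) (X : Cl n) : contract x (c • X) = c • contract x X := by
  simp [contract]

lemma contract_add_left (x y : V n) (X : Cl n) :
    contract (x + y) X = contract x X + contract y X := by
  simp [contract]

lemma contract_vecProd_eq_zero (x : V n) (l : List (V n)) (h : ∀ y ∈ l, ⟪x, y⟫ = 0) :
    contract x (vecProd l) = 0 := by
  induction l with
  | nil => exact contract_one x
  | cons y l ih =>
    rw [vecProd_cons, contract_ι_mul, h y (by simp), ih fun z hz => h z (by simp [hz])]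
    simp

/-- This is `xX = x∧X + x⌋X`. The change of form subtracts the contraction associated with `-Q`; the
two signs cancel. -/
lemma toGrassmann_ι_mul (x : V n) (X : Cl n) :
    toGrassmann n (ι (Q n) x * X) =
      ExteriorAlgebra.ι ℝ x * toGrassmann n X + toGrassmann n (contract x X) := by
  have h1 : toGrassmann n (ι (Q n) x * X) = ExteriorAlgebra.ι ℝ x * toGrassmann n X -
      contractLeft (QuadraticMap.associated (R := ℝ) (-Q n) x) (toGrassmann n X) :=
    changeForm_ι_mul changeForm.associated_neg_proof _ _
  have h2 : toGrassmann n (contract x X) = contractLeft (innerₗ (V n) x) (toGrassmann n X) :=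
    changeForm_contractLeft changeForm.associated_neg_proof _ _
  have h3 : QuadraticMap.associated (R := ℝ) (-Q n) x = - innerₗ (V n) x := by
    ext y
    simp only [QuadraticMap.associated_apply, neg_apply,
      LinearMap.BilinMap.toQuadraticMap_apply, innerₗ_apply_apply, LinearMap.neg_apply,
      inner_add_left, inner_add_right, real_inner_comm x y]
    simp
    ring
  rw [h1, h2, h3, map_neg, LinearMap.neg_apply, sub_neg_eq_add]

lemma toGrassmann_one : toGrassmann n 1 = 1 := changeForm_one changeForm.associated_neg_proof

lemma toGrassmann_vecProd (l : List (V n)) (h : l.Pairwise fun x y => ⟪x, y⟫ = 0) :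
    toGrassmann n (vecProd l) = (l.map (ExteriorAlgebra.ι ℝ)).prod := by
  induction l with
  | nil => exact toGrassmann_one
  | cons x l ih =>
    rw [List.pairwise_cons] at h
    rw [vecProd_cons, toGrassmann_ι_mul, contract_vecProd_eq_zero x l h.1, map_zero, add_zero,
      ih h.2, List.map_cons, List.prod_cons]

lemma outer_eq_vecProd {r : ℕ} (v : Fin r → V n) (h : Pairwise fun i j => ⟪v i, v j⟫ = 0) :
    outer v = vecProd (List.ofFn v) := by
  rw [outer, LinearEquiv.symm_apply_eq, toGrassmann_vecProd, ExteriorAlgebra.ιMulti_apply,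
    List.map_ofFn]
  · rfl
  · rw [List.pairwise_ofFn]
    exact fun i j hij => h hij.ne

lemma outer_pair (x y : V n) :
    outer ![x, y] = ι (Q n) x * ι (Q n) y - algebraMap ℝ _ ⟪x, y⟫ := by
  rw [outer, LinearEquiv.symm_apply_eq, map_sub]
  have h1 : toGrassmann n (ι (Q n) y) = ExteriorAlgebra.ι ℝ y :=
    changeForm_ι changeForm.associated_neg_proof _
  have h2 : toGrassmann n (algebraMap ℝ _ ⟪x, y⟫) = algebraMap ℝ _ ⟪x, y⟫ :=
    changeForm_algebraMap changeForm.associated_neg_proof _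
  have h3 : contract x (ι (Q n) y) = algebraMap ℝ _ ⟪x, y⟫ := contractLeft_ι _ _ y
  rw [toGrassmann_ι_mul, h1, h3, h2, ExteriorAlgebra.ιMulti_apply]
  simp

-- Grade, scalar part and magnitude of products of vectors

lemma gradePart_of_mem {k : ℕ} {X : Cl n} (h : toGrassmann n X ∈ ⋀[ℝ]^k (V n)) (j : ℕ) :
    gradePart j X = if k = j then X else 0 := by
  rw [gradePart, GradedAlgebra.proj_apply, LinearEquiv.symm_apply_eq]
  split_ifs with hkj
  · subst hkj
    rw [DirectSum.decompose_of_mem_same (fun i : ℕ => ⋀[ℝ]^i (V n)) h]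
  · rw [DirectSum.decompose_of_mem_ne (fun i : ℕ => ⋀[ℝ]^i (V n)) h hkj, map_zero]

lemma gradePart_smul (j : ℕ) (c : ℝ) (X : Cl n) : gradePart j (c • X) = c • gradePart j X := by
  simp [gradePart]

lemma gradePart_sum {κ : Type*} (j : ℕ) (s : Finset κ) (f : κ → Cl n) :
    gradePart j (∑ i ∈ s, f i) = ∑ i ∈ s, gradePart j (f i) := by
  simp [gradePart]

lemma gradePart_vecProd (l : List (V n)) (h : l.Pairwise fun x y => ⟪x, y⟫ = 0) (j : ℕ) :
    gradePart j (vecProd l) = if l.length = j then vecProd l else 0 := by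
  refine gradePart_of_mem ?_ j
  rw [toGrassmann_vecProd l h]
  clear h
  induction l with
  | nil => simp
  | cons x l ih =>
    rw [List.map_cons, List.prod_cons, List.length_cons, ExteriorAlgebra.exteriorPower, pow_succ']
    exact Submodule.mul_mem_mul ⟨x, rfl⟩ ih

lemma vecProd_mul_reverse (l : List (V n)) (h : ∀ x ∈ l, ‖x‖ = 1) :
    vecProd l * reverse (vecProd l) = 1 := by
  induction l with
  | nil => simp
  | cons x l ih =>
    rw [vecProd_cons, reverse.map_mul, reverse_ι, mul_assoc, ← mul_assoc (vecProd l),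
      ih fun z hz => h z (by simp [hz]), one_mul, ι_mul_self, real_inner_self_eq_norm_sq,
      h x (by simp)]
    simp

lemma reverse_mul_vecProd (l : List (V n)) (h : ∀ x ∈ l, ‖x‖ = 1) :
    reverse (vecProd l) * vecProd l = 1 := by
  induction l with
  | nil => simp
  | cons x l ih =>
    rw [vecProd_cons, reverse.map_mul, reverse_ι, mul_assoc, ← mul_assoc (ι (Q n) x), ι_mul_self,
      real_inner_self_eq_norm_sq, h x (by simp)]
    simpa using ih fun z hz => h z (by simp [hz])

lemma isUnit_vecProd (l : List (V n)) (h : ∀ x ∈ l, ‖x‖ = 1) : IsUnit (vecProd l) :=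
  ⟨⟨_, _, vecProd_mul_reverse l h, reverse_mul_vecProd l h⟩, rfl⟩

lemma scalarPart_algebraMap (c : ℝ) : scalarPart (algebraMap ℝ (Cl n) c) = c := by
  have h2 : toGrassmann n (algebraMap ℝ _ c) = algebraMap ℝ _ c :=
    changeForm_algebraMap changeForm.associated_neg_proof _
  rw [scalarPart, h2, ExteriorAlgebra.algebraMap_leftInverse]

lemma scalarPart_one : scalarPart (1 : Cl n) = 1 := by
  simpa using scalarPart_algebraMap (n := n) 1

lemma scalarPart_smul (c : ℝ) (X : Cl n) : scalarPart (c • X) = c * scalarPart X := by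
  simp [scalarPart]

lemma scalarPart_sum {κ : Type*} (s : Finset κ) (f : κ → Cl n) :
    scalarPart (∑ i ∈ s, f i) = ∑ i ∈ s, scalarPart (f i) := by
  simp [scalarPart]

lemma scalarPart_vecProd (l : List (V n)) (h : l.Pairwise fun x y => ⟪x, y⟫ = 0) (hl : l ≠ []) :
    scalarPart (vecProd l) = 0 := by
  obtain ⟨x, l, rfl⟩ := List.exists_cons_of_ne_nil hl
  rw [scalarPart, toGrassmann_vecProd _ h, List.map_cons, List.prod_cons, map_mul]
  have : ExteriorAlgebra.algebraMapInv (ExteriorAlgebra.ι ℝ x) = 0 := by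
    simp [ExteriorAlgebra.algebraMapInv]
  rw [this, zero_mul]

lemma magnitude_smul_vecProd (c : ℝ) (l : List (V n)) (h : ∀ x ∈ l, ‖x‖ = 1) :
    magnitude (c • vecProd l) = |c| := by
  rw [magnitude, map_smul, smul_mul_smul_comm, vecProd_mul_reverse l h, scalarPart_smul,
    scalarPart_one, mul_one, Real.sqrt_mul_self_eq_abs]

lemma ι_injective : Function.Injective (ι (Q n)) := by
  intro x y h
  have h1 : ∀ z : V n, toGrassmann n (ι (Q n) z) = ExteriorAlgebra.ι ℝ z :=
    fun z => changeForm_ι changeForm.associated_neg_proof z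
  have := congrArg (toGrassmann n) h
  rwa [h1, h1, ExteriorAlgebra.ι_inj] at this

-- Contraction and the subspace of a product of orthonormal vectors

/-- A list of pairwise orthogonal unit vectors. -/
def OrthonormalList (l : List (V n)) : Prop :=
  (l.Pairwise fun x y => ⟪x, y⟫ = 0) ∧ ∀ x ∈ l, ‖x‖ = 1

lemma OrthonormalList.ofFn {r : ℕ} {e : Fin r → V n} (h : Orthonormal ℝ e) :
    OrthonormalList (List.ofFn e) := by
  refine ⟨?_, ?_⟩
  · rw [List.pairwise_ofFn]
    exact fun i j hij => h.2 hij.ne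
  · simpa [List.mem_ofFn] using h.1

lemma contract_vecProd_of_mem {l : List (V n)} (h : OrthonormalList l) {x : V n} (hx : x ∈ l) :
    contract x (vecProd l) = ι (Q n) x * vecProd l := by
  induction l with
  | nil => simp at hx
  | cons y l ih =>
    obtain ⟨h1, h2⟩ := h
    rw [List.pairwise_cons] at h1
    rw [vecProd_cons, contract_ι_mul, ← mul_assoc]
    rcases List.mem_cons.mp hx with rfl | hx
    · rw [contract_vecProd_eq_zero x l h1.1, ι_mul_self, mul_zero, sub_zero, Algebra.smul_def]
    · have hyx : ⟪x, y⟫ = 0 := by rw [real_inner_comm]; exact h1.1 x hx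
      rw [ih ⟨h1.2, fun z hz => h2 z (by simp [hz])⟩ hx, hyx, zero_smul, zero_sub, ← mul_assoc,
        ι_mul_swap x y hyx, neg_mul]

lemma contract_vecProd_of_mem_span {l : List (V n)} (h : OrthonormalList l) {x : V n}
    (hx : x ∈ Submodule.span ℝ {y | y ∈ l}) :
    contract x (vecProd l) = ι (Q n) x * vecProd l := by
  induction hx using Submodule.span_induction with
  | mem x hx => exact contract_vecProd_of_mem h hx
  | zero => simp [contract]
  | add x y _ _ hx hy => rw [contract_add_left, hx, hy, map_add, add_mul]
  | smul c x _ hx =>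
    rw [map_smul, smul_mul_assoc, ← hx]
    simp [contract]

/-- The component of `x` orthogonal to the span contracts to zero, and for the component in the span
contraction is multiplication. As the product is a unit, both extreme cases can be recognized from
the contraction. -/
lemma contract_vecProd {l : List (V n)} (h : OrthonormalList l) (x : V n) :
    contract x (vecProd l) =
      ι (Q n) ((Submodule.span ℝ {y | y ∈ l}).starProjection x) * vecProd l := by
  set U := Submodule.span ℝ {y | y ∈ l}
  have h1 : contract (x - U.starProjection x) (vecProd l) = 0 := by
    refine contract_vecProd_eq_zero _ _ fun y hy => ?_
    have : x - U.starProjection x ∈ Uᗮ := Submodule.sub_starProjection_mem_orthogonal x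
    exact (Submodule.mem_orthogonal' _ _).mp this y (Submodule.subset_span hy)
  have h2 := contract_add_left (x - U.starProjection x) (U.starProjection x) (vecProd l)
  rw [sub_add_cancel, h1, zero_add] at h2
  rw [h2]
  exact contract_vecProd_of_mem_span h (Submodule.starProjection_apply_mem U x)

lemma contract_vecProd_eq_zero_iff {l : List (V n)} (h : OrthonormalList l) (x : V n) :
    contract x (vecProd l) = 0 ↔ ∀ y ∈ l, ⟪x, y⟫ = 0 := by
  refine ⟨fun h0 y hy => ?_, contract_vecProd_eq_zero x l⟩
  rw [contract_vecProd h, (isUnit_vecProd l h.2).mul_left_eq_zero] at h0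
  have h3 : (Submodule.span ℝ {y | y ∈ l}).starProjection x = 0 := ι_injective (by simpa using h0)
  have h4 := Submodule.sub_starProjection_mem_orthogonal (K := Submodule.span ℝ {y | y ∈ l}) x
  rw [h3, sub_zero] at h4
  exact (Submodule.mem_orthogonal' _ _).mp h4 y (Submodule.subset_span hy)

lemma contract_vecProd_eq_mul_iff {l : List (V n)} (h : OrthonormalList l) (x : V n) :
    contract x (vecProd l) = ι (Q n) x * vecProd l ↔ x ∈ Submodule.span ℝ {y | y ∈ l} := by
  refine ⟨fun h0 => ?_, contract_vecProd_of_mem_span h⟩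
  rw [contract_vecProd h, (isUnit_vecProd l h.2).mul_left_inj] at h0
  rw [← ι_injective h0]
  exact Submodule.starProjection_apply_mem _ x

/-- By `xX = x∧X + x⌋X`. This matches `bladeSpace` with the condition used in `BladeOrthogonal`. -/
lemma mem_bladeSpace (X : Cl n) (x : V n) :
    x ∈ bladeSpace X ↔ contract x X = ι (Q n) x * X := by
  have := toGrassmann_ι_mul x X
  change ExteriorAlgebra.ι ℝ x * toGrassmann n X = 0 ↔ _
  rw [← (toGrassmann n).injective.eq_iff, this]
  constructor
  · intro h; rw [h, zero_add]
  · intro h; simpa using h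

lemma bladeSpace_smul {c : ℝ} (hc : c ≠ 0) (X : Cl n) : bladeSpace (c • X) = bladeSpace X := by
  ext x
  rw [mem_bladeSpace, mem_bladeSpace, contract_smul, mul_smul_comm]
  exact (smul_right_injective _ hc).eq_iff

lemma bladeSpace_vecProd {l : List (V n)} (h : OrthonormalList l) :
    bladeSpace (vecProd l) = Submodule.span ℝ {y | y ∈ l} := by
  ext x
  rw [mem_bladeSpace, contract_vecProd_eq_mul_iff h]

-- Normed blades as signed products of orthonormal vectors

lemma alternatingMap_eq_det_smul {ι' M N : Type*} [Fintype ι'] [DecidableEq ι'] [AddCommGroup M]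
    [Module ℝ M] [AddCommGroup N] [Module ℝ N] (e : Module.Basis ι' ℝ M) (f : M [⋀^ι']→ₗ[ℝ] N)
    (v : ι' → M) : f v = e.det v • f e := by
  have : f = (LinearMap.toSpanSingleton ℝ N (f e)).compAlternatingMap e.det := by
    -- It suffices to compare on injective tuples of basis vectors; these are permutations of `e`,
    -- on which both sides change by the same sign.
    refine Module.Basis.ext_alternating e fun w hw => ?_
    let σ : Equiv.Perm ι' := Equiv.ofBijective w (Finite.injective_iff_bijective.mp hw)
    have h1 : f (fun i => e (w i)) = Equiv.Perm.sign σ • f e := f.map_perm e σ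
    have h2 : e.det (fun i => e (w i)) = Equiv.Perm.sign σ • e.det e := e.det.map_perm e σ
    rw [LinearMap.compAlternatingMap_apply, LinearMap.toSpanSingleton_apply, h1, h2,
      e.det_self, Units.smul_def, Units.smul_def, zsmul_eq_mul, mul_one, Int.cast_smul_eq_zsmul]
  conv_lhs => rw [this]
  simp [LinearMap.compAlternatingMap_apply]

lemma exists_outer_eq_smul {r : ℕ} {v e : Fin r → V n} (he : LinearIndependent ℝ e)
    (h : ∀ i, v i ∈ Submodule.span ℝ (Set.range e)) : ∃ c : ℝ, outer v = c • outer e := by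
  let b := Module.Basis.span he
  let w : Fin r → Submodule.span ℝ (Set.range e) := fun i => ⟨v i, h i⟩
  let f := (ExteriorAlgebra.ιMulti ℝ r (M := V n)).compLinearMap
    (Submodule.span ℝ (Set.range e)).subtype
  have hb : ∀ i, (b i : V n) = e i := fun i =>
    congrArg Subtype.val (Module.Basis.span_apply he i)
  have h1 : f w = ExteriorAlgebra.ιMulti ℝ r v := rfl
  have h2 : f b = ExteriorAlgebra.ιMulti ℝ r e := by
    simp only [f, AlternatingMap.compLinearMap_apply]
    congr 1
    ext1 i
    exact hb i
  refine ⟨b.det w, ?_⟩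
  rw [outer, outer, ← h1, ← h2, alternatingMap_eq_det_smul b f w, map_smul]

lemma outer_eq_zero {r : ℕ} {v : Fin r → V n} (h : ¬ LinearIndependent ℝ v) : outer v = 0 := by
  rw [outer, AlternatingMap.map_linearDependent _ v h, map_zero]

lemma outer_orthonormal {r : ℕ} {e : Fin r → V n} (he : Orthonormal ℝ e) :
    outer e = vecProd (List.ofFn e) :=
  outer_eq_vecProd e fun _ _ hij => he.2 hij

lemma bladeSpace_smul_vecProd {r : ℕ} {e : Fin r → V n} (he : Orthonormal ℝ e) {c : ℝ}
    (hc : c ≠ 0) : bladeSpace (c • vecProd (List.ofFn e)) = Submodule.span ℝ (Set.range e) := by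
  rw [bladeSpace_smul hc, bladeSpace_vecProd (.ofFn he)]
  congr 1
  ext x
  simp [List.mem_ofFn]

lemma span_range_coe {κ : Type*} [Fintype κ] {K : Submodule ℝ (V n)} (e : OrthonormalBasis κ ℝ K) :
    Submodule.span ℝ (Set.range fun i => (e i : V n)) = K := by
  have h1 : (Set.range fun i => (e i : V n)) = K.subtype '' Set.range e := by
    rw [← Set.range_comp]; rfl
  have h2 : Submodule.span ℝ (Set.range e) = ⊤ := by simpa using e.toBasis.span_eq
  rw [h1, Submodule.span_image, h2, Submodule.map_subtype_top]

/-- Magnitude one excludes dependent vectors, whose outer product is zero. Passing to an orthonormal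
basis of the span costs a scalar factor, which the magnitude forces to be `±1`. -/
lemma IsNormedBlade.exists_orthonormal {r : ℕ} {X : Cl n} (h : IsNormedBlade r X) :
    ∃ e : Fin r → V n, Orthonormal ℝ e ∧
      ∃ ε : ℝ, (ε = 1 ∨ ε = -1) ∧ X = ε • vecProd (List.ofFn e) := by
  obtain ⟨⟨v, rfl⟩, hm⟩ := h
  have hv : LinearIndependent ℝ v := by
    by_contra hv
    rw [outer_eq_zero hv] at hm
    simp [magnitude, scalarPart] at hm
  let U := Submodule.span ℝ (Set.range v)
  have hU : Module.finrank ℝ U = r := by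
    simpa using finrank_span_eq_card hv
  let e' := (stdOrthonormalBasis ℝ U).reindex (finCongr hU)
  let e : Fin r → V n := fun i => e' i
  have he : Orthonormal ℝ e := e'.orthonormal.comp_linearIsometry U.subtypeₗᵢ
  have hspan : ∀ i, v i ∈ Submodule.span ℝ (Set.range e) := by
    rw [span_range_coe e']
    exact fun i => Submodule.subset_span ⟨i, rfl⟩
  obtain ⟨c, hc⟩ := exists_outer_eq_smul he.linearIndependent hspan
  rw [outer_orthonormal he] at hc
  refine ⟨e, he, c, ?_, hc⟩
  rw [hc, magnitude_smul_vecProd _ _ (OrthonormalList.ofFn he).2] at hm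
  exact eq_or_eq_neg_of_abs_eq hm

lemma IsNormedBlade.eq_smul_vecProd {r : ℕ} {X : Cl n} (h : IsNormedBlade r X) {a : Fin r → V n}
    (ha : Orthonormal ℝ a) (hspan : Submodule.span ℝ (Set.range a) = bladeSpace X) :
    ∃ ε : ℝ, (ε = 1 ∨ ε = -1) ∧ X = ε • vecProd (List.ofFn a) := by
  obtain ⟨e, he, δ, hδ, rfl⟩ := h.exists_orthonormal
  have hδ0 : δ ≠ 0 := by rcases hδ with rfl | rfl <;> norm_num
  rw [bladeSpace_smul_vecProd he hδ0] at hspan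
  obtain ⟨c, hc⟩ := exists_outer_eq_smul (v := e) ha.linearIndependent fun i => by
    rw [hspan]; exact Submodule.subset_span ⟨i, rfl⟩
  rw [outer_orthonormal he, outer_orthonormal ha] at hc
  have hm := h.2
  rw [hc, smul_smul, magnitude_smul_vecProd _ _ (OrthonormalList.ofFn ha).2] at hm
  exact ⟨δ * c, eq_or_eq_neg_of_abs_eq hm, by rw [hc, smul_smul]⟩

lemma IsNormedBlade.finrank {r : ℕ} {X : Cl n} (h : IsNormedBlade r X) :
    Module.finrank ℝ (bladeSpace X) = r := by
  obtain ⟨e, he, δ, hδ, rfl⟩ := h.exists_orthonormal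
  have hδ0 : δ ≠ 0 := by rcases hδ with rfl | rfl <;> norm_num
  rw [bladeSpace_smul_vecProd he hδ0]
  simpa using finrank_span_eq_card he.linearIndependent

-- Existence of principal vectors

lemma inner_smul_smul_eq_zero {E : Type*} [NormedAddCommGroup E] [InnerProductSpace ℝ E] {x y : E}
    (h : ⟪x, y⟫ = 0) (c d : ℝ) : ⟪c • x, d • y⟫ = 0 := by
  rw [real_inner_smul_left, real_inner_smul_right, h, mul_zero, mul_zero]

/-- Principal vectors exist for any two subspaces of the same dimension. -/
lemma exists_isPrincipalSystem {r : ℕ} (U W : Submodule ℝ (V n)) (hU : Module.finrank ℝ U = r)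
    (hW : Module.finrank ℝ W = r) : ∃ a b : Fin r → V n, IsPrincipalSystem U W a b := by
  -- Singular value decomposition of the projection `U → W`: eigenvectors of `T*T` are the `aₖ`, and
  -- their images have the directions of the `bₖ`.
  let T : U →ₗ[ℝ] W := W.orthogonalProjectionOnto.toLinearMap ∘ₗ U.subtype
  have hT : ∀ (x : U) (y : W), ⟪(x : V n), (y : V n)⟫ = ⟪T x, y⟫ := fun x y =>
    (Submodule.inner_orthogonalProjectionOnto_eq_of_mem_right y (x : V n)).symm
  have hS : (LinearMap.adjoint T ∘ₗ T).IsSymmetric := fun x y => by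
    simp [LinearMap.adjoint_inner_left, LinearMap.adjoint_inner_right]
  let a' := hS.eigenvectorBasis hU
  have hTa : ∀ k l, k ≠ l → ⟪T (a' k), T (a' l)⟫ = 0 := fun k l hkl => by
    rw [← LinearMap.adjoint_inner_left]
    have := hS.apply_eigenvectorBasis hU k
    rw [LinearMap.comp_apply] at this
    change LinearMap.adjoint T (T (a' k)) = _ at this
    rw [this, real_inner_smul_left, a'.orthonormal.2 hkl, mul_zero]
  let w : Fin r → W := fun k => ‖T (a' k)‖⁻¹ • T (a' k)
  let s : Set (Fin r) := {k | T (a' k) ≠ 0}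
  have hw : Orthonormal ℝ (s.domRestrict w) := by
    refine ⟨fun k => ?_, fun k l hkl => ?_⟩
    · change ‖‖T (a' k)‖⁻¹ • T (a' k)‖ = 1
      rw [norm_smul, norm_inv, norm_norm, inv_mul_cancel₀ (norm_ne_zero_iff.mpr k.2)]
    · exact inner_smul_smul_eq_zero (hTa k l fun h => hkl (Subtype.ext h)) _ _
  -- Where `T aₖ = 0`, any completion to an orthonormal basis serves, since such an `aₖ` is
  -- orthogonal to all of `W`.
  obtain ⟨b', hb'⟩ := hw.exists_orthonormalBasis_extension_of_card_eq (by simpa using hW)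
  have hab : ∀ k l, ⟪((a' k : U) : V n), ((b' l : W) : V n)⟫ = ‖T (a' k)‖ * ⟪b' k, b' l⟫ := by
    intro k l
    rw [hT]
    by_cases hk : T (a' k) = 0
    · simp [hk]
    · rw [hb' k hk, ← real_inner_smul_left, smul_inv_smul₀ (norm_ne_zero_iff.mpr hk)]
  refine ⟨fun k => a' k, fun k => b' k, ?_, ?_, span_range_coe a', span_range_coe b', ?_, ?_⟩
  · exact a'.orthonormal.comp_linearIsometry U.subtypeₗᵢ
  · exact b'.orthonormal.comp_linearIsometry W.subtypeₗᵢ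
  · intro k l hkl
    rw [hab, b'.orthonormal.2 hkl, mul_zero]
  · intro k
    rw [hab]
    exact mul_nonneg (norm_nonneg _) real_inner_self_nonneg

-- Commuting plane bivectors and the rotor product

-- Allows finite products and their expansion to be computed in the commutative subalgebra generated
-- by the `i k`.
open scoped IsMulCommutative in
lemma exists_commRing_lift {κ : Type*} {A : Type} [Ring A] [Algebra ℝ A] (i : κ → A)
    (h : ∀ k l, i k * i l = i l * i k) :
    ∃ (R : Type) (_ : CommRing R) (_ : Algebra ℝ R) (φ : R →ₐ[ℝ] A) (j : κ → R),
      ∀ k, φ (j k) = i k := by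
  have hcomm : ∀ x ∈ Set.range i, ∀ y ∈ Set.range i, x * y = y * x := by
    rintro _ ⟨k, rfl⟩ _ ⟨l, rfl⟩
    exact h k l
  have := Algebra.isMulCommutative_adjoin ℝ hcomm
  exact ⟨Algebra.adjoin ℝ (Set.range i), inferInstance,
    (Algebra.adjoin ℝ (Set.range i)).algebra, (Algebra.adjoin ℝ (Set.range i)).val,
    fun k => ⟨i k, Algebra.subset_adjoin ⟨k, rfl⟩⟩, fun _ => rfl⟩

/-- The unit vector completing `a k` to an orthonormal basis of the `k`-th principal plane. -/
def planeNormal {r : ℕ} (a b : Fin r → V n) (k : Fin r) : V n :=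
  (Real.sin (ang a b k))⁻¹ • (b k - Real.cos (ang a b k) • a k)

/-- The vector anticommutes with both `a k` and `b k`, and the two signs cancel. -/
lemma planeBivector_commute_ι {r : ℕ} (a b : Fin r → V n) (k : Fin r) (x : V n)
    (ha : ⟪a k, x⟫ = 0) (hb : ⟪b k, x⟫ = 0) :
    Commute (planeBivector a b k) (ι (Q n) x) := by
  rw [planeBivector, outer_pair]
  refine Commute.smul_left (Commute.sub_left ?_ (Algebra.commute_algebraMap_left _ _)) _
  rw [Commute, SemiconjBy, mul_assoc, ι_mul_swap _ _ hb, mul_neg, ← mul_assoc, ι_mul_swap _ _ ha,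
    neg_mul, neg_neg, mul_assoc]

lemma mem_parIdx {r : ℕ} (a b : Fin r → V n) (k : Fin r) : k ∈ parIdx a b ↔ ang a b k = 0 := by simp [parIdx]

lemma mem_perpIdx {r : ℕ} (a b : Fin r → V n) (k : Fin r) : k ∈ perpIdx a b ↔ ang a b k = Real.pi / 2 := by simp [perpIdx]

lemma mem_midIdx {r : ℕ} (a b : Fin r → V n) (k : Fin r) : k ∈ midIdx a b ↔ 0 < ang a b k ∧ ang a b k < Real.pi / 2 := by
  simp [midIdx]

lemma ang_nonneg {r : ℕ} (a b : Fin r → V n) (k : Fin r) : 0 ≤ ang a b k :=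
  InnerProductGeometry.angle_nonneg _ _

lemma disjoint_par_mid {r : ℕ} (a b : Fin r → V n) : Disjoint (parIdx a b) (midIdx a b) := by
  rw [Finset.disjoint_left]
  intro k
  rw [mem_parIdx, mem_midIdx]
  intro h1 h2
  linarith [h2.1]

lemma disjoint_parmid_perp {r : ℕ} (a b : Fin r → V n) :
    Disjoint (parIdx a b ∪ midIdx a b) (perpIdx a b) := by
  rw [Finset.disjoint_left]
  intro k
  rw [Finset.mem_union, mem_parIdx, mem_midIdx, mem_perpIdx]
  rintro (h1 | h1) h2
  · linarith [Real.pi_pos]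
  · linarith [h1.2]

namespace IsPrincipalSystem

variable {r : ℕ} {U W : Submodule ℝ (V n)} {a b : Fin r → V n} (h : IsPrincipalSystem U W a b)

include h

lemma cos_ang (k : Fin r) : Real.cos (ang a b k) = ⟪a k, b k⟫ := by
  rw [ang, InnerProductGeometry.cos_angle, h.orthonormal_left.1, h.orthonormal_right.1]
  simp

lemma ang_le (k : Fin r) : ang a b k ≤ Real.pi / 2 := by
  rw [ang, InnerProductGeometry.angle, h.orthonormal_left.1, h.orthonormal_right.1,
    Real.arccos_le_pi_div_two]
  simpa using h.inner_nonneg k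

lemma sin_pos {k : Fin r} (hk : ang a b k ≠ 0) : 0 < Real.sin (ang a b k) :=
  Real.sin_pos_of_pos_of_lt_pi (lt_of_le_of_ne (ang_nonneg a b k) (Ne.symm hk))
    (by linarith [h.ang_le k, Real.pi_pos])

lemma eq_of_ang_eq_zero {k : Fin r} (hk : ang a b k = 0) : a k = b k := by
  have := h.cos_ang k
  rw [hk, Real.cos_zero] at this
  exact (inner_eq_one_iff_of_norm_eq_one (h.orthonormal_left.1 k) (h.orthonormal_right.1 k)).mp
    this.symm

lemma eq_cos_add_sin (k : Fin r) :
    b k = Real.cos (ang a b k) • a k + Real.sin (ang a b k) • planeNormal a b k := by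
  by_cases hk : ang a b k = 0
  · rw [hk, h.eq_of_ang_eq_zero hk]
    simp
  · rw [planeNormal, smul_inv_smul₀ (h.sin_pos hk).ne']
    abel

lemma inner_left_normal (k l : Fin r) : ⟪a k, planeNormal a b l⟫ = 0 := by
  rw [planeNormal, real_inner_smul_right, inner_sub_right, real_inner_smul_right]
  by_cases hkl : k = l
  · subst hkl
    rw [h.cos_ang, real_inner_self_eq_norm_sq, h.orthonormal_left.1]
    simp
  · rw [h.inner_ne k l hkl, h.orthonormal_left.2 hkl]
    simp

lemma inner_normal_normal {k l : Fin r} (hkl : k ≠ l) :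
    ⟪planeNormal a b k, planeNormal a b l⟫ = 0 := by
  conv_lhs => rw [planeNormal]
  rw [real_inner_smul_left, inner_sub_left, real_inner_smul_left, h.inner_left_normal,
    planeNormal, real_inner_smul_right, inner_sub_right, real_inner_smul_right,
    h.orthonormal_right.2 hkl, real_inner_comm (a l), h.inner_ne l k hkl.symm]
  simp

lemma norm_normal {k : Fin r} (hk : ang a b k ≠ 0) : ‖planeNormal a b k‖ = 1 := by
  have hs := (h.sin_pos hk).ne'
  have h1 : ⟪b k, b k⟫ = 1 := by
    rw [real_inner_self_eq_norm_sq, h.orthonormal_right.1, one_pow]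
  have h2 : ⟪a k, a k⟫ = 1 := by
    rw [real_inner_self_eq_norm_sq, h.orthonormal_left.1, one_pow]
  have h3 := h.inner_left_normal k k
  have h4 : ⟪planeNormal a b k, a k⟫ = 0 := by rw [real_inner_comm, h3]
  rw [h.eq_cos_add_sin k] at h1
  simp only [inner_add_left, inner_add_right, real_inner_smul_left, real_inner_smul_right, h2, h3,
    h4] at h1
  have h5 : Real.sin (ang a b k) ^ 2 * ⟪planeNormal a b k, planeNormal a b k⟫ =
      Real.sin (ang a b k) ^ 2 * 1 := by
    linarith [Real.sin_sq_add_cos_sq (ang a b k)]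
  have h6 := mul_left_cancel₀ (pow_ne_zero 2 hs) h5
  rw [real_inner_self_eq_norm_sq] at h6
  exact (pow_eq_one_iff_of_nonneg (norm_nonneg _) two_ne_zero).mp h6

lemma planeBivector_eq_smul (k : Fin r) : planeBivector a b k =
    (Real.sin (ang a b k))⁻¹ •
      (ι (Q n) (a k) * ι (Q n) (b k) - algebraMap ℝ _ (Real.cos (ang a b k))) := by
  rw [planeBivector, outer_pair, h.cos_ang]

/-- No angle condition is needed: at angle zero both sides vanish because `0⁻¹ = 0`. -/
lemma planeBivector_eq (k : Fin r) :
    planeBivector a b k = ι (Q n) (a k) * ι (Q n) (planeNormal a b k) := by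
  rw [h.planeBivector_eq_smul, planeNormal, map_smul, map_sub, map_smul, mul_smul_comm, mul_sub,
    mul_smul_comm, ι_mul_self, real_inner_self_eq_norm_sq, h.orthonormal_left.1]
  simp [Algebra.algebraMap_eq_smul_one]

lemma ι_mul_ι (k : Fin r) : ι (Q n) (a k) * ι (Q n) (b k) =
    algebraMap ℝ _ (Real.cos (ang a b k)) + Real.sin (ang a b k) • planeBivector a b k := by
  by_cases hk : ang a b k = 0
  · rw [← h.eq_of_ang_eq_zero hk, ι_mul_self, real_inner_self_eq_norm_sq, h.orthonormal_left.1, hk]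
    simp
  · rw [h.planeBivector_eq_smul, smul_inv_smul₀ (h.sin_pos hk).ne']
    abel

lemma inner_ne' {k l : Fin r} (hkl : k ≠ l) : ⟪b k, a l⟫ = 0 := by
  rw [real_inner_comm]; exact h.inner_ne l k hkl.symm

lemma planeBivector_commute (k l : Fin r) :
    Commute (planeBivector a b k) (planeBivector a b l) := by
  by_cases hkl : k = l
  · rw [hkl]
  rw [h.planeBivector_eq_smul l]
  refine Commute.smul_right (Commute.sub_right (Commute.mul_right ?_ ?_) ?_) _
  · exact planeBivector_commute_ι a b k _ (h.orthonormal_left.2 hkl) (h.inner_ne' hkl)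
  · exact planeBivector_commute_ι a b k _ (h.inner_ne k l hkl) (h.orthonormal_right.2 hkl)
  · exact (Algebra.commute_algebraMap_right _ _)

/-- Induction on the nesting: the inner product lives in the other principal planes, so `b k` moves
past it to meet `a k`. -/
lemma vecProd_mul_reverse_map (l : List (Fin r)) (hl : l.Nodup) :
    vecProd (l.map a) * reverse (vecProd (l.map b)) =
      (l.map fun k => algebraMap ℝ (Cl n) (Real.cos (ang a b k)) +
        Real.sin (ang a b k) • planeBivector a b k).prod := by
  induction l with
  | nil => simp
  | cons k l ih =>
    rw [List.nodup_cons] at hl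
    rw [List.map_cons, List.map_cons, vecProd_cons, vecProd_cons, reverse.map_mul, reverse_ι,
      mul_assoc, ← mul_assoc (vecProd (l.map a)), ih hl.2, List.map_cons, List.prod_cons,
      ← h.ι_mul_ι, mul_assoc]
    congr 1
    refine Commute.list_prod_left _ _ fun x hx => ?_
    obtain ⟨m, hm, rfl⟩ := List.mem_map.mp hx
    have hmk : m ≠ k := fun e => hl.1 (e ▸ hm)
    exact Commute.add_left (Algebra.commute_algebraMap_left _ _) (Commute.smul_left
      (planeBivector_commute_ι a b m _ (h.inner_ne m k hmk) (h.orthonormal_right.2 hmk)) _)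

lemma exists_commRing : ∃ (R : Type) (_ : CommRing R) (_ : Algebra ℝ R) (φ : R →ₐ[ℝ] Cl n)
    (j : Fin r → R), (∀ k, φ (j k) = planeBivector a b k) ∧
      ∀ S, planeProd a b S = φ (∏ k ∈ S, j k) := by
  obtain ⟨R, _, _, φ, j, hj⟩ := exists_commRing_lift (planeBivector a b) h.planeBivector_commute
  refine ⟨R, inferInstance, inferInstance, φ, j, hj, fun S => ?_⟩
  have h1 : ∏ k ∈ S, j k = ((S.sort (· ≤ ·)).map j).prod := by
    conv_lhs => rw [← Finset.sort_toFinset (s := S) (r := (· ≤ ·))]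
    rw [List.prod_toFinset _ (Finset.sort_nodup _ _)]
  rw [h1, map_list_prod, List.map_map, planeProd]
  congr 2
  ext1 k
  exact (hj k).symm

lemma univ_eq : (Finset.univ : Finset (Fin r)) = parIdx a b ∪ midIdx a b ∪ perpIdx a b := by
  ext k
  simp only [Finset.mem_univ, Finset.mem_union, mem_parIdx, mem_midIdx, mem_perpIdx, true_iff]
  rcases (ang_nonneg a b k).eq_or_lt with h1 | h1
  · exact Or.inl (Or.inl h1.symm)
  · rcases (h.ang_le k).lt_or_eq with h2 | h2
    · exact Or.inl (Or.inr ⟨h1, h2⟩)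
    · exact Or.inr h2

lemma card_add : (parIdx a b).card + (midIdx a b).card + (perpIdx a b).card = r := by
  have := congrArg Finset.card h.univ_eq
  rw [Finset.card_union_of_disjoint (disjoint_parmid_perp a b),
    Finset.card_union_of_disjoint (disjoint_par_mid a b), Finset.card_fin] at this
  exact this.symm

/-- The product of the principal vectors is the product of the rotors. -/
lemma vecProd_mul_reverse_eq_rotorSum :
    vecProd (List.ofFn a) * reverse (vecProd (List.ofFn b)) = rotorSum a b := by
  obtain ⟨R, _, _, φ, j, hj, hφ⟩ := h.exists_commRing
  rw [List.ofFn_eq_map, List.ofFn_eq_map, h.vecProd_mul_reverse_map _ (List.nodup_finRange r)]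
  have h1 : (List.finRange r).map (fun k => algebraMap ℝ (Cl n) (Real.cos (ang a b k)) +
      Real.sin (ang a b k) • planeBivector a b k) = ((List.finRange r).map fun k =>
        algebraMap ℝ R (Real.cos (ang a b k)) + Real.sin (ang a b k) • j k).map φ := by
    rw [List.map_map]
    congr 1
    ext1 k
    simp [hj]
  -- Angles zero contribute factors `1`, right angles the pure bivectors.
  have h2 : ((List.finRange r).map fun k =>
        algebraMap ℝ R (Real.cos (ang a b k)) + Real.sin (ang a b k) • j k).prod =
      (∏ k ∈ midIdx a b, (Real.sin (ang a b k) • j k + algebraMap ℝ R (Real.cos (ang a b k)))) *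
        ∏ k ∈ perpIdx a b, j k := by
    have h3 : ∀ f : Fin r → R, ((List.finRange r).map f).prod = ∏ k, f k := fun f => by
      rw [← List.ofFn_eq_map, List.prod_ofFn]
    rw [h3, h.univ_eq, Finset.prod_union (disjoint_parmid_perp a b),
      Finset.prod_union (disjoint_par_mid a b), Finset.prod_eq_one, one_mul]
    · congr 1
      · exact Finset.prod_congr rfl fun k _ => add_comm _ _
      · refine Finset.prod_congr rfl fun k hk => ?_
        rw [(mem_perpIdx a b k).mp hk]
        simp
    · intro k hk
      rw [(mem_parIdx a b k).mp hk]
      simp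
  rw [h1, ← map_list_prod, h2, map_mul, rotorSum, hφ, Finset.prod_add, map_sum]
  congr 1
  refine Finset.sum_congr rfl fun S _ => ?_
  rw [hφ, ← map_smul, Finset.prod_smul, ← map_prod, mul_comm, ← Algebra.smul_def, smul_smul,
    mul_comm]

end IsPrincipalSystem

-- Grades of sums indexed by subsets

section Expansion

variable {κ : Type*} {M : Finset κ} {m : ℕ} {Y : Finset κ → Cl n}

/-- For `S ⊆ M`, the multivector `Y S` is a product of `m + 2 |S|` orthonormal vectors. -/
def IsBladeFamily (M : Finset κ) (m : ℕ) (Y : Finset κ → Cl n) : Prop :=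
  ∀ S ⊆ M, ∃ l : List (V n), OrthonormalList l ∧ l.length = m + 2 * S.card ∧ Y S = vecProd l

lemma IsBladeFamily.magnitude_smul (hY : IsBladeFamily M m Y) {S : Finset κ} (hS : S ⊆ M) (c : ℝ) :
    magnitude (c • Y S) = |c| := by
  obtain ⟨l, hl, -, h⟩ := hY S hS
  rw [h, magnitude_smul_vecProd _ _ hl.2]

lemma IsBladeFamily.isUnit (hY : IsBladeFamily M m Y) {S : Finset κ} (hS : S ⊆ M) :
    IsUnit (Y S) := by
  obtain ⟨l, hl, -, h⟩ := hY S hS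
  rw [h]
  exact isUnit_vecProd l hl.2

lemma IsBladeFamily.gradePart_sum (hY : IsBladeFamily M m Y) (w : Finset κ → ℝ) (j : ℕ) :
    gradePart j (∑ S ∈ M.powerset, w S • Y S) =
      ∑ S ∈ M.powerset with m + 2 * S.card = j, w S • Y S := by
  rw [SubspaceAngles.gradePart_sum, Finset.sum_filter]
  refine Finset.sum_congr rfl fun S hS => ?_
  obtain ⟨l, hl, hlen, h⟩ := hY S (Finset.mem_powerset.mp hS)
  rw [gradePart_smul, h, gradePart_vecProd l hl.1, hlen]
  split_ifs <;> simp

lemma IsBladeFamily.gradePart_of_lt (hY : IsBladeFamily M m Y) (w : Finset κ → ℝ) {j : ℕ}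
    (hj : j < m) : gradePart j (∑ S ∈ M.powerset, w S • Y S) = 0 := by
  rw [hY.gradePart_sum, Finset.filter_false_of_mem, Finset.sum_empty]
  intro S _
  omega

lemma IsBladeFamily.gradePart_of_gt (hY : IsBladeFamily M m Y) (w : Finset κ → ℝ) {j : ℕ}
    (hj : m + 2 * M.card < j) : gradePart j (∑ S ∈ M.powerset, w S • Y S) = 0 := by
  rw [hY.gradePart_sum, Finset.filter_false_of_mem, Finset.sum_empty]
  intro S hS
  have := Finset.card_le_card (Finset.mem_powerset.mp hS)
  omega

lemma IsBladeFamily.gradePart_lowest (hY : IsBladeFamily M m Y) (w : Finset κ → ℝ) :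
    gradePart m (∑ S ∈ M.powerset, w S • Y S) = w ∅ • Y ∅ := by
  have : (M.powerset.filter fun S => m + 2 * S.card = m) = {∅} := by
    ext S
    simp only [Finset.mem_filter, Finset.mem_powerset, Finset.mem_singleton]
    constructor
    · rintro ⟨-, h⟩
      exact Finset.card_eq_zero.mp (by omega)
    · rintro rfl
      simp
  rw [hY.gradePart_sum, this, Finset.sum_singleton]

lemma IsBladeFamily.gradePart_highest (hY : IsBladeFamily M m Y) (w : Finset κ → ℝ) :
    gradePart (m + 2 * M.card) (∑ S ∈ M.powerset, w S • Y S) = w M • Y M := by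
  have : (M.powerset.filter fun S => m + 2 * S.card = m + 2 * M.card) = {M} := by
    ext S
    simp only [Finset.mem_filter, Finset.mem_powerset, Finset.mem_singleton]
    constructor
    · rintro ⟨h1, h2⟩
      exact Finset.eq_of_subset_of_card_le h1 (by omega)
    · rintro rfl
      simp
  rw [hY.gradePart_sum, this, Finset.sum_singleton]

lemma IsBladeFamily.gradePart_two (hY : IsBladeFamily M 0 Y) (w : Finset κ → ℝ) :
    gradePart 2 (∑ S ∈ M.powerset, w S • Y S) = ∑ k ∈ M, w {k} • Y {k} := by
  have : (M.powerset.filter fun S => 0 + 2 * S.card = 2) =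
      M.map ⟨_, Finset.singleton_injective⟩ := by
    rw [← Finset.powersetCard_one]
    ext S
    simp only [Finset.mem_filter, Finset.mem_powerset, Finset.mem_powersetCard]
    exact and_congr_right fun _ => by omega
  rw [hY.gradePart_sum, this, Finset.sum_map]
  rfl

lemma IsBladeFamily.scalarPart_sum (hY : IsBladeFamily M 0 Y) (w : Finset κ → ℝ) :
    scalarPart (∑ S ∈ M.powerset, w S • Y S) = w ∅ := by
  rw [SubspaceAngles.scalarPart_sum, Finset.sum_eq_single ∅]
  · obtain ⟨l, -, hlen, h⟩ := hY ∅ (Finset.empty_subset M)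
    have hnil : l = [] := List.eq_nil_of_length_eq_zero (by simpa using hlen)
    rw [h, scalarPart_smul, hnil, vecProd_nil, scalarPart_one, mul_one]
  · intro S hS hne
    obtain ⟨l, hl, hlen, h⟩ := hY S (Finset.mem_powerset.mp hS)
    rw [h, scalarPart_smul, scalarPart_vecProd l hl.1, mul_zero]
    rintro rfl
    have := Finset.card_pos.mpr (Finset.nonempty_iff_ne_empty.mpr hne)
    rw [List.length_nil] at hlen
    omega
  · intro h
    simp at h

end Expansion

-- The terms of the expansion as products of orthonormal vectors

lemma inner_normal_eq_zero {r : ℕ} {a b : Fin r → V n} {x : V n} {k : Fin r} (ha : ⟪x, a k⟫ = 0)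
    (hb : ⟪x, b k⟫ = 0) : ⟪x, planeNormal a b k⟫ = 0 := by
  rw [planeNormal, real_inner_smul_right, inner_sub_right, real_inner_smul_right, ha, hb]
  simp

namespace IsPrincipalSystem

variable {r : ℕ} {U W : Submodule ℝ (V n)} {a b : Fin r → V n} (h : IsPrincipalSystem U W a b)

include h

lemma orthonormalList_planes {q : ℕ} {e : Fin q → V n} (he : Orthonormal ℝ e)
    (hea : ∀ i k, ⟪e i, a k⟫ = 0) (heb : ∀ i k, ⟪e i, b k⟫ = 0) {l : List (Fin r)}
    (hl : l.Nodup) (hl' : ∀ k ∈ l, ang a b k ≠ 0) :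
    OrthonormalList (List.ofFn e ++ l.flatMap fun k => [a k, planeNormal a b k]) := by
  constructor
  · rw [List.pairwise_append]
    refine ⟨(OrthonormalList.ofFn he).1, ?_, ?_⟩
    · rw [List.pairwise_flatMap]
      refine ⟨fun k _ => by simpa using h.inner_left_normal k k, hl.imp fun {k m} hkm => ?_⟩
      simp only [List.mem_cons, List.not_mem_nil, or_false]
      rintro x (rfl | rfl) y (rfl | rfl)
      · exact h.orthonormal_left.2 hkm
      · exact h.inner_left_normal _ _
      · rw [real_inner_comm]
        exact h.inner_left_normal _ _
      · exact h.inner_normal_normal hkm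
    · intro x hx y hy
      obtain ⟨i, rfl⟩ := (List.mem_ofFn' _ _).mp hx
      obtain ⟨k, -, hk⟩ := List.mem_flatMap.mp hy
      simp only [List.mem_cons, List.not_mem_nil, or_false] at hk
      rcases hk with rfl | rfl
      · exact hea i k
      · exact inner_normal_eq_zero (hea i k) (heb i k)
  · intro x hx
    rcases List.mem_append.mp hx with hx | hx
    · exact (OrthonormalList.ofFn he).2 x hx
    · obtain ⟨k, hk, hx⟩ := List.mem_flatMap.mp hx
      simp only [List.mem_cons, List.not_mem_nil, or_false] at hx
      rcases hx with rfl | rfl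
      · exact h.orthonormal_left.1 k
      · exact h.norm_normal (hl' k hk)

lemma vecProd_planes (l : List (Fin r)) :
    vecProd (l.flatMap fun k => [a k, planeNormal a b k]) = (l.map (planeBivector a b)).prod := by
  induction l with
  | nil => simp
  | cons k l ih =>
    rw [List.flatMap_cons, vecProd_append, ih, List.map_cons, List.prod_cons, h.planeBivector_eq]
    simp

/-- Each `𝐢ₖ` is written as `aₖnₖ`; the angles over `S` and `P` are non-zero, so all `nₖ` are unit
vectors. The set `P` is kept variable to cover both `AB̃` (all right angles) and the quotient `W`
(`P` empty). -/
lemma isBladeFamily {q : ℕ} {e : Fin q → V n} (he : Orthonormal ℝ e)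
    (hea : ∀ i k, ⟪e i, a k⟫ = 0) (heb : ∀ i k, ⟪e i, b k⟫ = 0) {P : Finset (Fin r)}
    (hP : P ⊆ perpIdx a b) :
    IsBladeFamily (midIdx a b) (2 * P.card + q)
      fun S => vecProd (List.ofFn e) * planeProd a b S * planeProd a b P := by
  intro S hS
  have h0 : ∀ k ∈ S, 0 < ang a b k ∧ ang a b k < Real.pi / 2 := fun k hk =>
    (mem_midIdx a b k).mp (hS hk)
  have h1 : ∀ k ∈ P, ang a b k = Real.pi / 2 := fun k hk => (mem_perpIdx a b k).mp (hP hk)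
  refine ⟨_, h.orthonormalList_planes he hea heb
    (l := S.sort (· ≤ ·) ++ P.sort (· ≤ ·)) ?_ ?_, ?_, ?_⟩
  · refine List.Nodup.append (Finset.sort_nodup _ _) (Finset.sort_nodup _ _) ?_
    intro k hk hk'
    simp only [Finset.mem_sort] at hk hk'
    linarith [(h0 k hk).2, h1 k hk']
  · intro k hk
    simp only [List.mem_append, Finset.mem_sort] at hk
    rcases hk with hk | hk
    · exact (h0 k hk).1.ne'
    · rw [h1 k hk]
      exact (half_pos Real.pi_pos).ne'
  · simp
    ring
  · rw [vecProd_append, h.vecProd_planes, List.map_append, List.prod_append, ← mul_assoc]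
    rfl

end IsPrincipalSystem

-- Uniqueness of orthogonal splittings of a bivector

/-- The multiplicity of a non-zero eigenvalue `c` of `x ↦ ∑ μᵢ ⟪gᵢ, x⟫ gᵢ`, `g` orthonormal, is
the number of `i` with `μᵢ = c`. -/
lemma card_eq_finrank_eigenspace {κ E : Type*} [Fintype κ] [NormedAddCommGroup E]
    [InnerProductSpace ℝ E] {g : κ → E} (hg : Orthonormal ℝ g) (μ : κ → ℝ) (T : E →ₗ[ℝ] E)
    (hT : ∀ x, T x = ∑ i, (μ i * ⟪g i, x⟫) • g i) {c : ℝ} (hc : c ≠ 0) :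
    Nat.card {i // μ i = c} = Module.finrank ℝ (Module.End.eigenspace T c) := by
  classical
  have hspan : Module.End.eigenspace T c =
      Submodule.span ℝ (Set.range fun i : {i // μ i = c} => g i) := by
    apply le_antisymm
    · intro x hx
      rw [Module.End.mem_eigenspace_iff, hT] at hx
      -- As `c ≠ 0`, the eigenvector equation itself puts `x` in the span of `g`; comparing
      -- coefficients then kills those with `μ i ≠ c`.
      have h1 : x = ∑ i, (c⁻¹ * (μ i * ⟪g i, x⟫)) • g i := by
        simp_rw [mul_smul c⁻¹]
        rw [← Finset.smul_sum, hx, inv_smul_smul₀ hc]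
      rw [h1]
      refine Submodule.sum_mem _ fun i _ => ?_
      have h2 : μ i * ⟪g i, x⟫ = c * ⟪g i, x⟫ := by
        have := congrArg (fun y => ⟪g i, y⟫) hx
        simpa only [hg.inner_right_fintype, real_inner_smul_right] using this
      by_cases hi : μ i = c
      · exact Submodule.smul_mem _ _ (Submodule.subset_span ⟨⟨i, hi⟩, rfl⟩)
      · have h3 : ⟪g i, x⟫ = 0 := by
          by_contra h3
          exact hi (mul_right_cancel₀ h3 h2)
        rw [h3]
        simp
    · rw [Submodule.span_le]
      rintro _ ⟨⟨i, hi⟩, rfl⟩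
      rw [SetLike.mem_coe, Module.End.mem_eigenspace_iff, hT, Finset.sum_eq_single i]
      · rw [real_inner_self_eq_norm_sq, hg.1, hi]
        simp
      · intro j _ hj
        rw [hg.2 hj]
        simp
      · simp
  rw [hspan, Nat.card_eq_fintype_card]
  exact (finrank_span_eq_card (hg.linearIndependent.comp _ Subtype.val_injective)).symm

lemma contract_outer_pair (x u v : V n) :
    contract x (outer ![u, v]) = ι (Q n) (⟪u, x⟫ • v - ⟪v, x⟫ • u) := by
  have h1 : contract x (ι (Q n) v) = algebraMap ℝ _ ⟪x, v⟫ := contractLeft_ι _ _ v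
  have h2 := contract_ι_mul x u (ι (Q n) v)
  have h3 : contract x (outer ![u, v]) = contract x (ι (Q n) u * ι (Q n) v) := by
    rw [outer_pair]
    simp [contract, contractLeft_algebraMap]
  rw [h3, h2, h1, map_sub, map_smul, map_smul, ← Algebra.commutes, ← Algebra.smul_def,
    real_inner_comm x u, real_inner_comm x v]

/-- The endomorphism `x ↦ x ⌋ F` of a bivector `F = ∑ⱼ τⱼ uⱼ ∧ vⱼ`. -/
def bivectorEnd {κ : Type*} [Fintype κ] (τ : κ → ℝ) (u v : κ → V n) : V n →ₗ[ℝ] V n where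
  toFun x := ∑ j, τ j • (⟪u j, x⟫ • v j - ⟪v j, x⟫ • u j)
  map_add' x y := by
    rw [← Finset.sum_add_distrib]
    refine Finset.sum_congr rfl fun j _ => ?_
    rw [inner_add_right, inner_add_right]
    module
  map_smul' c x := by
    rw [RingHom.id_apply, Finset.smul_sum]
    refine Finset.sum_congr rfl fun j _ => ?_
    rw [real_inner_smul_right, real_inner_smul_right]
    module

lemma bivectorEnd_apply {κ : Type*} [Fintype κ] (τ : κ → ℝ) (u v : κ → V n) (x : V n) :
    bivectorEnd τ u v x = ∑ j, τ j • (⟪u j, x⟫ • v j - ⟪v j, x⟫ • u j) := rfl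

lemma contract_sum_outer_pair {κ : Type*} [Fintype κ] (τ : κ → ℝ) (u v : κ → V n) (x : V n) :
    contract x (∑ j, τ j • outer ![u j, v j]) = ι (Q n) (bivectorEnd τ u v x) := by
  rw [bivectorEnd_apply, map_sum]
  simp_rw [map_smul, ← contract_outer_pair]
  simp [contract]

lemma bivectorEnd_sq_apply {κ : Type*} [Fintype κ] {τ : κ → ℝ} {u v : κ → V n}
    (h : Orthonormal ℝ (Sum.elim u v)) (x : V n) :
    (-(bivectorEnd τ u v ∘ₗ bivectorEnd τ u v)) x =
      ∑ i, (Sum.elim (fun j => τ j ^ 2) (fun j => τ j ^ 2) i * ⟪Sum.elim u v i, x⟫) •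
        Sum.elim u v i := by
  classical
  have huu : ∀ i j, ⟪u i, u j⟫ = if i = j then 1 else 0 := fun i j => by
    simpa using orthonormal_iff_ite.mp h (.inl i) (.inl j)
  have hvv : ∀ i j, ⟪v i, v j⟫ = if i = j then 1 else 0 := fun i j => by
    simpa using orthonormal_iff_ite.mp h (.inr i) (.inr j)
  have huv : ∀ i j, ⟪u i, v j⟫ = 0 := fun i j => by
    simpa using orthonormal_iff_ite.mp h (.inl i) (.inr j)
  have hvu : ∀ i j, ⟪v i, u j⟫ = 0 := fun i j => by rw [real_inner_comm, huv]
  have h1 : ∀ i, ⟪u i, bivectorEnd τ u v x⟫ = -(τ i * ⟪v i, x⟫) := fun i => by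
    simp [bivectorEnd_apply, inner_sum, real_inner_smul_right, inner_sub_right, huu, huv]
  have h2 : ∀ i, ⟪v i, bivectorEnd τ u v x⟫ = τ i * ⟪u i, x⟫ := fun i => by
    simp [bivectorEnd_apply, inner_sum, real_inner_smul_right, inner_sub_right, hvv, hvu]
  rw [LinearMap.neg_apply, LinearMap.comp_apply, bivectorEnd_apply, Fintype.sum_sum_type,
    ← Finset.sum_add_distrib, ← Finset.sum_neg_distrib]
  refine Finset.sum_congr rfl fun j _ => ?_
  rw [h1, h2]
  simp only [Sum.elim_inl, Sum.elim_inr]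
  module

lemma card_sum_elim {κ : Type*} [Finite κ] (f : κ → ℝ) (c : ℝ) :
    Nat.card {i // Sum.elim f f i = c} = 2 * Nat.card {j // f j = c} := by
  rw [Nat.card_congr Equiv.subtypeSum, Nat.card_sum]
  simp only [Sum.elim_inl, Sum.elim_inr]
  ring

lemma IsSplitting.multiset_eq {κ κ' : Type} [Fintype κ] [Fintype κ'] {F : Cl n} {τ : κ → ℝ}
    {J : κ → Cl n} {τ' : κ' → ℝ} {J' : κ' → Cl n} (h : IsSplitting F τ J)
    (h' : IsSplitting F τ' J') :
    (Finset.univ : Finset κ).val.map τ = (Finset.univ : Finset κ').val.map τ' := by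
  classical
  obtain ⟨⟨u, v, huv, hJ⟩, hτ, hF⟩ := h
  obtain ⟨⟨u', v', huv', hJ'⟩, hτ', hF'⟩ := h'
  have hT : bivectorEnd τ u v = bivectorEnd τ' u' v' := by
    ext1 x
    apply ι_injective
    rw [← contract_sum_outer_pair, ← contract_sum_outer_pair]
    simp_rw [← hJ, ← hJ']
    rw [← hF, hF']
  -- Each plane contributes `uⱼ` and `vⱼ`, so both eigenspace counts carry a factor two, which
  -- cancels.
  have hcard : ∀ c : ℝ, 0 < c → Nat.card {j // τ j ^ 2 = c} = Nat.card {j // τ' j ^ 2 = c} := by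
    intro c hc
    have h1 := card_eq_finrank_eigenspace huv _ _ (bivectorEnd_sq_apply (τ := τ) huv) hc.ne'
    have h2 := card_eq_finrank_eigenspace huv' _ _ (bivectorEnd_sq_apply (τ := τ') huv') hc.ne'
    rw [card_sum_elim] at h1 h2
    rw [hT] at h1
    omega
  -- Positivity allows `σ j` to be recovered from its square.
  have hcount : ∀ {κ : Type} [Fintype κ] (σ : κ → ℝ) (c : ℝ), (∀ j, 0 < σ j) → 0 < c →
      ((Finset.univ : Finset κ).val.map σ).count c = Nat.card {j // σ j ^ 2 = c ^ 2} := by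
    intro κ _ σ c hσ hc
    rw [Multiset.count_map, Nat.card_eq_fintype_card, Fintype.card_subtype]
    change (Finset.univ.filter fun j => c = σ j).card = _
    congr 1
    ext j
    simp only [Finset.mem_filter, Finset.mem_univ, true_and]
    rw [pow_left_inj₀ (hσ j).le hc.le two_ne_zero, eq_comm]
  ext c
  by_cases hc : 0 < c
  · rw [hcount τ c hτ hc, hcount τ' c hτ' hc, hcard _ (by positivity)]
  · rw [Multiset.count_eq_zero_of_notMem, Multiset.count_eq_zero_of_notMem]
    · rintro hm
      obtain ⟨j, -, rfl⟩ := Multiset.mem_map.mp hm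
      exact hc (hτ' j)
    · rintro hm
      obtain ⟨j, -, rfl⟩ := Multiset.mem_map.mp hm
      exact hc (hτ j)

-- Signs, orthogonal blades and the tangent form of the expansion

lemma ne_zero_of_eq_one_or_neg_one {ε : ℝ} (h : ε = 1 ∨ ε = -1) : ε ≠ 0 := by
  rcases h with rfl | rfl <;> norm_num

lemma abs_eq_one_of_eq_one_or_neg_one {ε : ℝ} (h : ε = 1 ∨ ε = -1) : |ε| = 1 := by
  rcases h with rfl | rfl <;> simp

lemma mul_eq_one_or_neg_one {ε δ : ℝ} (h : ε = 1 ∨ ε = -1) (h' : δ = 1 ∨ δ = -1) :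
    ε * δ = 1 ∨ ε * δ = -1 := by
  rcases h with rfl | rfl <;> rcases h' with rfl | rfl <;> simp

lemma BladeOrthogonal.inner_eq_zero {r : ℕ} {X Y : Cl n} (h : BladeOrthogonal X Y)
    (hY : IsNormedBlade r Y) {x y : V n} (hx : x ∈ bladeSpace X) (hy : y ∈ bladeSpace Y) :
    ⟪x, y⟫ = 0 := by
  obtain ⟨f, hf, δ, hδ, rfl⟩ := hY.exists_orthonormal
  have hδ0 := ne_zero_of_eq_one_or_neg_one hδ
  have h1 := h x ((mem_bladeSpace X x).mp hx)
  rw [contract_smul, smul_eq_zero_iff_right hδ0, contract_vecProd_eq_zero_iff (.ofFn hf)] at h1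
  rw [bladeSpace_smul_vecProd hf hδ0] at hy
  induction hy using Submodule.span_induction with
  | mem y hy =>
    obtain ⟨i, rfl⟩ := hy
    exact h1 _ ((List.mem_ofFn' _ _).mpr ⟨i, rfl⟩)
  | zero => exact inner_zero_right x
  | add y z _ _ hy hz => rw [inner_add_right, hy, hz, add_zero]
  | smul c y _ hy => rw [real_inner_smul_right, hy, mul_zero]

lemma planeProd_empty {r : ℕ} (a b : Fin r → V n) : planeProd a b ∅ = 1 := by simp [planeProd]

lemma planeProd_singleton {r : ℕ} (a b : Fin r → V n) (k : Fin r) : planeProd a b {k} = planeBivector a b k := by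
  simp [planeProd]

lemma planeProd_commute_vecProd {r : ℕ} {a b : Fin r → V n} {l : List (V n)} (hea : ∀ x ∈ l, ∀ k, ⟪x, a k⟫ = 0)
    (heb : ∀ x ∈ l, ∀ k, ⟪x, b k⟫ = 0) (S : Finset (Fin r)) :
    Commute (planeProd a b S) (vecProd l) := by
  refine Commute.list_prod_left _ _ fun y hy => Commute.list_prod_right _ _ fun z hz => ?_
  obtain ⟨k, -, rfl⟩ := List.mem_map.mp hy
  obtain ⟨x, hx, rfl⟩ := List.mem_map.mp hz
  refine planeBivector_commute_ι a b k x ?_ ?_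
  · rw [real_inner_comm]; exact hea x hx k
  · rw [real_inner_comm]; exact heb x hx k

lemma cos_ang_pos {r : ℕ} {a b : Fin r → V n} {k : Fin r} (hk : k ∈ midIdx a b) : 0 < Real.cos (ang a b k) := by
  have := (mem_midIdx a b k).mp hk
  exact Real.cos_pos_of_mem_Ioo ⟨by linarith [Real.pi_pos], this.2⟩

lemma tan_ang_pos {r : ℕ} {a b : Fin r → V n} {k : Fin r} (hk : k ∈ midIdx a b) : 0 < Real.tan (ang a b k) := by
  have := (mem_midIdx a b k).mp hk
  exact Real.tan_pos_of_pos_of_lt_pi_div_two this.1 this.2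

lemma prod_cos_pos {r : ℕ} (a b : Fin r → V n) : 0 < ∏ k ∈ midIdx a b, Real.cos (ang a b k) :=
  Finset.prod_pos fun _ hk => cos_ang_pos hk

lemma prod_sin_mul_prod_cos {r : ℕ} {a b : Fin r → V n} {S : Finset (Fin r)} (hS : S ⊆ midIdx a b) :
    (∏ k ∈ S, Real.sin (ang a b k)) * ∏ k ∈ midIdx a b \ S, Real.cos (ang a b k) =
      (∏ k ∈ midIdx a b, Real.cos (ang a b k)) * ∏ k ∈ S, Real.tan (ang a b k) := by
  rw [← Finset.prod_sdiff hS, mul_assoc, ← Finset.prod_mul_distrib, mul_comm]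
  congr 1
  refine Finset.prod_congr rfl fun k hk => ?_
  rw [mul_comm, Real.tan_mul_cos (cos_ang_pos (hS hk)).ne']

/-- Normalizes the term of `S = ∅` to `1`; the inner sum is the later quotient `W`. -/
lemma rotorSum_eq_tan {r : ℕ} (a b : Fin r → V n) :
    rotorSum a b = (∏ k ∈ midIdx a b, Real.cos (ang a b k)) •
    ((∑ S ∈ (midIdx a b).powerset, (∏ k ∈ S, Real.tan (ang a b k)) • planeProd a b S) *
      planeProd a b (perpIdx a b)) := by
  rw [rotorSum, ← smul_mul_assoc, Finset.smul_sum]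
  congr 1
  refine Finset.sum_congr rfl fun S hS => ?_
  rw [smul_smul, prod_sin_mul_prod_cos (Finset.mem_powerset.mp hS)]

namespace IsPrincipalSystem

variable {r : ℕ} {U W : Submodule ℝ (V n)} {a b : Fin r → V n} (h : IsPrincipalSystem U W a b)

include h

lemma left_mem (k : Fin r) : a k ∈ U := h.span_left ▸ Submodule.subset_span ⟨k, rfl⟩

lemma right_mem (k : Fin r) : b k ∈ W := h.span_right ▸ Submodule.subset_span ⟨k, rfl⟩

/-- Reversing one of the vectors of an orthogonal pair of principal vectors. -/
lemma update_neg {k : Fin r} (hk : k ∈ perpIdx a b) :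
    IsPrincipalSystem U W a (Function.update b k (-b k)) := by
  have h0 : ⟪a k, b k⟫ = 0 := by
    rw [← h.cos_ang, (mem_perpIdx a b k).mp hk, Real.cos_pi_div_two]
  refine ⟨h.orthonormal_left, ⟨fun i => ?_, fun i j hij => ?_⟩, h.span_left, ?_, ?_, ?_⟩
  · rcases eq_or_ne i k with rfl | hi
    · simpa using h.orthonormal_right.1 i
    · simpa [hi] using h.orthonormal_right.1 i
  · have hij' := h.orthonormal_right.2 hij
    simp only [Function.update_apply]
    split_ifs <;> simp_all
  · rw [← h.span_right]
    refine le_antisymm (Submodule.span_le.mpr ?_) (Submodule.span_le.mpr ?_)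
    · rintro _ ⟨i, rfl⟩
      have := Submodule.subset_span (R := ℝ) (Set.mem_range_self (f := b) i)
      rcases eq_or_ne i k with rfl | hi
      · simpa using this
      · simpa [hi] using this
    · rintro _ ⟨i, rfl⟩
      have := Submodule.subset_span (R := ℝ) (Set.mem_range_self (f := Function.update b k (-b k)) i)
      rcases eq_or_ne i k with rfl | hi
      · simpa using this
      · simpa [hi] using this
  · intro i j hij
    have hij' := h.inner_ne i j hij
    rcases eq_or_ne j k with rfl | hj
    · simpa using hij'
    · simpa [hj] using hij'
  · intro i
    rcases eq_or_ne i k with rfl | hi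
    · simp [h0]
    · simpa [hi] using h.inner_nonneg i

lemma vecProd_update_neg {k : Fin r} (hk : k ∈ perpIdx a b) :
    vecProd (List.ofFn (Function.update b k (-b k))) = -vecProd (List.ofFn b) := by
  rw [← outer_orthonormal (h.update_neg hk).orthonormal_right,
    ← outer_orthonormal h.orthonormal_right, outer, outer, AlternatingMap.map_update_neg,
    Function.update_eq_self, map_neg]

lemma planeProd_commute (S T : Finset (Fin r)) :
    Commute (planeProd a b S) (planeProd a b T) := by
  obtain ⟨R, _, _, φ, j, -, hφ⟩ := h.exists_commRing
  rw [hφ, hφ]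
  exact (Commute.all _ _).map φ

lemma prod_sin_pos : 0 < ∏ k ∈ midIdx a b, Real.sin (ang a b k) :=
  Finset.prod_pos fun k hk => h.sin_pos ((mem_midIdx a b k).mp hk).1.ne'

lemma isBladeFamily_planeProd : IsBladeFamily (midIdx a b) 0 (planeProd a b) := by
  have := h.isBladeFamily (q := 0) (e := Fin.elim0) ⟨fun i => i.elim0, fun i => i.elim0⟩
    (fun i => i.elim0) (fun i => i.elim0) (Finset.empty_subset _)
  simpa [planeProd_empty] using this

/-- Without right angles the scalar part is the product of the cosines. This decides the sign when
no principal vector can be reversed. -/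
lemma scalarPart_rotorSum (hP : perpIdx a b = ∅) : 0 < scalarPart (rotorSum a b) := by
  rw [rotorSum_eq_tan, scalarPart_smul, hP, planeProd_empty, mul_one,
    h.isBladeFamily_planeProd.scalarPart_sum]
  simpa using prod_cos_pos a b

lemma isSplitting : IsSplitting
    (∑ k ∈ midIdx a b, Real.tan (ang a b k) • planeBivector a b k)
    (fun k : ↥(midIdx a b) => Real.tan (ang a b k))
    (fun k : ↥(midIdx a b) => planeBivector a b k) := by
  refine ⟨⟨fun k => a k, fun k => planeNormal a b k, ⟨?_, ?_⟩, fun k => ?_⟩,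
    fun k => tan_ang_pos k.2, ?_⟩
  · rintro (k | k)
    · exact h.orthonormal_left.1 k
    · exact h.norm_normal ((mem_midIdx a b k).mp k.2).1.ne'
  · rintro (k | k) (l | l) hkl
    · exact h.orthonormal_left.2 fun e => hkl (by rw [Subtype.ext e])
    · exact h.inner_left_normal k l
    · rw [real_inner_comm]
      exact h.inner_left_normal l k
    · exact h.inner_normal_normal fun e => hkl (by rw [Subtype.ext e])
  · change planeBivector a b k = outer ![a k, planeNormal a b k]
    rw [outer_pair, h.inner_left_normal, h.planeBivector_eq, map_zero, sub_zero]
  · exact (Finset.sum_coe_sort (midIdx a b)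
      fun k => Real.tan (ang a b k) • planeBivector a b k).symm

lemma map_arctan_eq {m : ℕ} {τ : Fin m → ℝ} {J : Fin m → Cl n}
    (hJ : IsSplitting (∑ k ∈ midIdx a b, Real.tan (ang a b k) • planeBivector a b k) τ J) :
    (Finset.univ : Finset (Fin m)).val.map (fun j => Real.arctan (τ j)) =
      (midIdx a b).val.map (ang a b) := by
  have h1 := congrArg (Multiset.map Real.arctan) (hJ.multiset_eq h.isSplitting)
  rw [Multiset.map_map, Multiset.map_map] at h1
  refine h1.trans ?_
  rw [Finset.univ_eq_attach, Finset.attach_val, ← Multiset.attach_map_val' (midIdx a b).val]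
  refine Multiset.map_congr rfl fun k _ => ?_
  have := (mem_midIdx a b k).mp k.2
  exact Real.arctan_tan (by linarith [Real.pi_pos]) this.2

/-- The intersection with `W` of an orthogonal extension of `U` is spanned by the common principal
vectors. -/
lemma card_parIdx {E : Set (V n)} (hea : ∀ x ∈ E, ∀ k, ⟪x, a k⟫ = 0)
    (heb : ∀ x ∈ E, ∀ k, ⟪x, b k⟫ = 0) :
    (parIdx a b).card = Module.finrank ℝ ↥(Submodule.span ℝ (E ∪ Set.range a) ⊓ W) := by
  have hspan : Submodule.span ℝ (E ∪ Set.range a) ⊓ W =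
      Submodule.span ℝ (Set.range fun k : ↥(parIdx a b) => b k) := by
    apply le_antisymm
    · rintro x ⟨hxA, hxB⟩
      rw [SetLike.mem_coe, ← h.span_right] at hxB
      -- Membership in the first span gives this relation, membership in `W` gives the mirrored one
      -- `h2`; together they yield `sin² θₖ ⟪b k, x⟫ = 0`.
      have h1 : ∀ k, ⟪b k, x⟫ = Real.cos (ang a b k) * ⟪a k, x⟫ := by
        clear hxB
        intro k
        induction hxA using Submodule.span_induction with
        | mem y hy =>
          rcases hy with hy | ⟨l, rfl⟩
          · rw [real_inner_comm, heb y hy, real_inner_comm, hea y hy, mul_zero]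
          · rw [h.cos_ang]
            rcases eq_or_ne k l with rfl | hkl
            · rw [real_inner_self_eq_norm_sq, h.orthonormal_left.1, real_inner_comm]
              simp
            · rw [h.inner_ne' hkl, h.orthonormal_left.2 hkl, mul_zero]
        | zero => simp
        | add y z _ _ hy hz => rw [inner_add_right, inner_add_right, hy, hz, mul_add]
        | smul c y _ hy =>
          rw [real_inner_smul_right, real_inner_smul_right, hy]
          ring
      have h2 : ∀ k, ⟪a k, x⟫ = Real.cos (ang a b k) * ⟪b k, x⟫ := by
        clear hxA h1
        intro k
        induction hxB using Submodule.span_induction with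
        | mem y hy =>
          obtain ⟨l, rfl⟩ := hy
          rw [h.cos_ang]
          rcases eq_or_ne k l with rfl | hkl
          · rw [real_inner_self_eq_norm_sq, h.orthonormal_right.1]
            simp
          · rw [h.inner_ne k l hkl, h.orthonormal_right.2 hkl, mul_zero]
        | zero => simp
        | add y z _ _ hy hz => rw [inner_add_right, inner_add_right, hy, hz, mul_add]
        | smul c y _ hy =>
          rw [real_inner_smul_right, real_inner_smul_right, hy]
          ring
      have h3 : x = ∑ k, ⟪b k, x⟫ • b k := by
        obtain ⟨c, rfl⟩ := (Submodule.mem_span_range_iff_exists_fun ℝ).mp hxB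
        exact Finset.sum_congr rfl fun k _ => by rw [h.orthonormal_right.inner_right_fintype]
      rw [h3]
      refine Submodule.sum_mem _ fun k _ => ?_
      by_cases hk : ang a b k = 0
      · exact Submodule.smul_mem _ _ (Submodule.subset_span ⟨⟨k, (mem_parIdx a b k).mpr hk⟩, rfl⟩)
      · have h4 := h.sin_pos hk
        have h5 : Real.sin (ang a b k) ^ 2 * ⟪b k, x⟫ = 0 := by
          rw [Real.sin_sq, sub_mul, one_mul, pow_two, mul_assoc, ← h2, ← h1, sub_self]
        rw [(mul_eq_zero_iff_left (pow_ne_zero 2 h4.ne')).mp h5, zero_smul]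
        exact Submodule.zero_mem _
    · rw [Submodule.span_le]
      rintro _ ⟨⟨k, hk⟩, rfl⟩
      refine ⟨?_, h.right_mem k⟩
      change b k ∈ _
      rw [← h.eq_of_ang_eq_zero ((mem_parIdx a b k).mp hk)]
      exact Submodule.subset_span (Or.inr ⟨k, rfl⟩)
  rw [hspan, ← Fintype.card_coe]
  exact (finrank_span_eq_card
    (h.orthonormal_right.linearIndependent.comp _ Subtype.val_injective)).symm

end IsPrincipalSystem

-- The product `AB̃` for a factorization of `A`

lemma IsFactorization.exists_orthonormal {q r : ℕ} {A B A₁ A₂ : Cl n}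
    (hfac : IsFactorization q r A B A₁ A₂) (hB : IsNormedBlade r B) :
    ∃ (e : Fin q → V n) (ε : ℝ), Orthonormal ℝ e ∧ (ε = 1 ∨ ε = -1) ∧
      A₁ = ε • vecProd (List.ofFn e) ∧ (∀ i, ∀ x ∈ bladeSpace A₂, ⟪e i, x⟫ = 0) ∧
      ∀ i, ∀ x ∈ bladeSpace B, ⟪e i, x⟫ = 0 := by
  obtain ⟨e, he, ε, hε, hA₁⟩ := hfac.normed_left.exists_orthonormal
  have hmem : ∀ i, e i ∈ bladeSpace A₁ := fun i => by
    rw [hA₁, bladeSpace_smul_vecProd he (ne_zero_of_eq_one_or_neg_one hε)]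
    exact Submodule.subset_span ⟨i, rfl⟩
  exact ⟨e, ε, he, hε, hA₁,
    fun i x hx => hfac.orth_right.inner_eq_zero hfac.normed_right (hmem i) hx,
    fun i x hx => hfac.orth_blade.inner_eq_zero hB (hmem i) hx⟩

/-- The product formula, up to sign, together with an orthonormal factorization of `A₁`. -/
lemma IsFactorization.exists_expansion {q r : ℕ} {A B A₁ A₂ : Cl n}
    (hfac : IsFactorization q r A B A₁ A₂) (hB : IsNormedBlade r B) {a b : Fin r → V n}
    (h : IsPrincipalSystem (bladeSpace A₂) (bladeSpace B) a b) :
    ∃ (e : Fin q → V n) (δ ε : ℝ), Orthonormal ℝ e ∧ (δ = 1 ∨ δ = -1) ∧ (ε = 1 ∨ ε = -1) ∧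
      A₁ = δ • vecProd (List.ofFn e) ∧ (∀ i k, ⟪e i, a k⟫ = 0) ∧ (∀ i k, ⟪e i, b k⟫ = 0) ∧
      A * reverse B = ε • (A₁ * rotorSum a b) ∧
      A * reverse B = ∑ S ∈ (midIdx a b).powerset,
        (ε * δ * ((∏ k ∈ S, Real.sin (ang a b k)) *
          ∏ k ∈ midIdx a b \ S, Real.cos (ang a b k))) •
        (vecProd (List.ofFn e) * planeProd a b S * planeProd a b (perpIdx a b)) := by
  obtain ⟨e, δ, he, hδ, hA₁, hea, heb⟩ := hfac.exists_orthonormal hB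
  obtain ⟨ε₂, hε₂, hA₂⟩ := hfac.normed_right.eq_smul_vecProd h.orthonormal_left h.span_left
  obtain ⟨ε₃, hε₃, hB'⟩ := hB.eq_smul_vecProd h.orthonormal_right h.span_right
  have hX : A * reverse B = (ε₂ * ε₃) • (A₁ * rotorSum a b) := by
    conv_lhs => rw [hfac.eq_mul, hA₂, hB']
    rw [map_smul, mul_assoc, smul_mul_smul_comm, h.vecProd_mul_reverse_eq_rotorSum, mul_smul_comm]
  refine ⟨e, δ, ε₂ * ε₃, he, hδ, mul_eq_one_or_neg_one hε₂ hε₃, hA₁,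
    fun i k => hea i _ (h.left_mem k), fun i k => heb i _ (h.right_mem k), hX, ?_⟩
  rw [hX, hA₁, rotorSum, smul_mul_assoc, smul_smul, ← mul_assoc, Finset.mul_sum, Finset.sum_mul,
    Finset.smul_sum]
  refine Finset.sum_congr rfl fun S _ => ?_
  rw [mul_smul_comm, smul_mul_assoc, smul_smul]

lemma IsFactorization.gradePart_eq_zero_of_lt {q r : ℕ} {A B A₁ A₂ : Cl n}
    (hfac : IsFactorization q r A B A₁ A₂) (hB : IsNormedBlade r B) {a b : Fin r → V n}
    (h : IsPrincipalSystem (bladeSpace A₂) (bladeSpace B) a b) {j : ℕ}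
    (hj : j < 2 * (perpIdx a b).card + q) : gradePart j (A * reverse B) = 0 := by
  obtain ⟨e, δ, ε, he, hδ, hε, hA₁, hea, heb, -, hX⟩ := hfac.exists_expansion hB h
  rw [hX]
  exact (h.isBladeFamily he hea heb subset_rfl).gradePart_of_lt _ hj

lemma IsFactorization.gradePart_lowest {q r : ℕ} {A B A₁ A₂ : Cl n}
    (hfac : IsFactorization q r A B A₁ A₂) (hB : IsNormedBlade r B) {a b : Fin r → V n}
    (h : IsPrincipalSystem (bladeSpace A₂) (bladeSpace B) a b) :
    gradePart (2 * (perpIdx a b).card + q) (A * reverse B) ≠ 0 := by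
  obtain ⟨e, δ, ε, he, hδ, hε, hA₁, hea, heb, -, hX⟩ := hfac.exists_expansion hB h
  have hY := h.isBladeFamily he hea heb subset_rfl
  rw [hX, hY.gradePart_lowest]
  refine smul_ne_zero (mul_ne_zero (ne_zero_of_eq_one_or_neg_one (mul_eq_one_or_neg_one hε hδ)) ?_)
    (hY.isUnit (Finset.empty_subset _)).ne_zero
  simpa using (prod_cos_pos a b).ne'

/-- Both numbers are read off from the lowest non-zero grade of the same multivector `AB̃`. -/
lemma IsFactorization.card_perpIdx_eq {q r : ℕ} {A B A₁ A₂ A₁' A₂' : Cl n}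
    (hfac : IsFactorization q r A B A₁ A₂) (hfac' : IsFactorization q r A B A₁' A₂')
    (hB : IsNormedBlade r B) {a b a' b' : Fin r → V n}
    (h : IsPrincipalSystem (bladeSpace A₂) (bladeSpace B) a b)
    (h' : IsPrincipalSystem (bladeSpace A₂') (bladeSpace B) a' b') :
    (perpIdx a' b').card = (perpIdx a b).card := by
  rcases lt_trichotomy (perpIdx a' b').card (perpIdx a b).card with hlt | heq | hlt
  · exact absurd (hfac.gradePart_eq_zero_of_lt hB h (by omega)) (hfac'.gradePart_lowest hB h')
  · exact heq
  · exact absurd (hfac'.gradePart_eq_zero_of_lt hB h' (by omega)) (hfac.gradePart_lowest hB h)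

lemma IsFactorization.card_parIdx_eq {q r : ℕ} {A B A₁ A₂ : Cl n}
    (hfac : IsFactorization q r A B A₁ A₂) (hB : IsNormedBlade r B) {a b : Fin r → V n}
    (h : IsPrincipalSystem (bladeSpace A₂) (bladeSpace B) a b) :
    (parIdx a b).card = Module.finrank ℝ ↥(bladeSpace A ⊓ bladeSpace B) := by
  obtain ⟨e, δ, he, hδ, hA₁, hea, heb⟩ := hfac.exists_orthonormal hB
  obtain ⟨ε, hε, hA₂⟩ := hfac.normed_right.eq_smul_vecProd h.orthonormal_left h.span_left
  have hl : OrthonormalList (List.ofFn e ++ List.ofFn a) := by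
    refine ⟨List.pairwise_append.mpr ⟨(OrthonormalList.ofFn he).1,
      (OrthonormalList.ofFn h.orthonormal_left).1, fun x hx y hy => ?_⟩, fun x hx => ?_⟩
    · obtain ⟨i, rfl⟩ := (List.mem_ofFn' _ _).mp hx
      obtain ⟨k, rfl⟩ := (List.mem_ofFn' _ _).mp hy
      exact hea i _ (h.left_mem k)
    · rcases List.mem_append.mp hx with hx | hx
      · exact (OrthonormalList.ofFn he).2 x hx
      · exact (OrthonormalList.ofFn h.orthonormal_left).2 x hx
  have hA : bladeSpace A = Submodule.span ℝ (Set.range e ∪ Set.range a) := by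
    rw [hfac.eq_mul, hA₁, hA₂, smul_mul_smul_comm, ← vecProd_append,
      bladeSpace_smul (ne_zero_of_eq_one_or_neg_one (mul_eq_one_or_neg_one hδ hε)),
      bladeSpace_vecProd hl]
    congr 1
    ext x
    simp [List.mem_ofFn]
  rw [hA]
  refine h.card_parIdx ?_ ?_
  · rintro _ ⟨i, rfl⟩ k
    exact hea i _ (h.left_mem k)
  · rintro _ ⟨i, rfl⟩ k
    exact heb i _ (h.right_mem k)

/-- For compatibly oriented blades the product formula holds without a sign. -/
lemma IsFactorization.exists_eq_rotorSum {q r : ℕ} {A B A₁ A₂ : Cl n}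
    (hfac : IsFactorization q r A B A₁ A₂) (hB : IsNormedBlade r B)
    (h0 : 0 ≤ scalarPart (A₂ * reverse B)) :
    ∃ a b : Fin r → V n, IsPrincipalSystem (bladeSpace A₂) (bladeSpace B) a b ∧
      A * reverse B = A₁ * rotorSum a b := by
  obtain ⟨a, b, h⟩ := exists_isPrincipalSystem (bladeSpace A₂) (bladeSpace B)
    hfac.normed_right.finrank hB.finrank
  obtain ⟨ε₂, hε₂, hA₂⟩ := hfac.normed_right.eq_smul_vecProd h.orthonormal_left h.span_left
  obtain ⟨ε₃, hε₃, hB'⟩ := hB.eq_smul_vecProd h.orthonormal_right h.span_right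
  have hX : A₂ * reverse B = (ε₂ * ε₃) • rotorSum a b := by
    conv_lhs => rw [hA₂, hB']
    rw [map_smul, smul_mul_smul_comm, h.vecProd_mul_reverse_eq_rotorSum]
  have hA : A * reverse B = A₁ * (A₂ * reverse B) := by rw [hfac.eq_mul, mul_assoc]
  rcases mul_eq_one_or_neg_one hε₂ hε₃ with hε | hε
  · exact ⟨a, b, h, by rw [hA, hX, hε, one_smul]⟩
  -- With the wrong sign and no right angle, the scalar part would be negative; otherwise reversing
  -- one `b k` at a right angle flips the sign.
  · rcases (perpIdx a b).eq_empty_or_nonempty with hP | ⟨k, hk⟩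
    · rw [hX, hε, scalarPart_smul] at h0
      linarith [h.scalarPart_rotorSum hP]
    · refine ⟨a, Function.update b k (-b k), h.update_neg hk, ?_⟩
      rw [← (h.update_neg hk).vecProd_mul_reverse_eq_rotorSum, h.vecProd_update_neg hk, map_neg,
        mul_neg, h.vecProd_mul_reverse_eq_rotorSum, hA, hX, hε, neg_one_smul]

end SubspaceAngles

end

-- Assembly of the theorem

theorem mainTheorem4 (n q r : ℕ) (A B A₁ A₂ : SubspaceAngles.Cl n)
    (hA : SubspaceAngles.IsNormedBlade (r + q) A)
    (hB : SubspaceAngles.IsNormedBlade r B)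
    (hfac : SubspaceAngles.IsFactorization q r A B A₁ A₂) :
    -- principal vectors exist
    (∃ a b : Fin r → SubspaceAngles.V n,
      SubspaceAngles.IsPrincipalSystem
        (SubspaceAngles.bladeSpace A₂) (SubspaceAngles.bladeSpace B) a b) ∧
    -- for compatibly oriented blades they can be chosen such that the formula holds exactly
    (0 ≤ SubspaceAngles.scalarPart (A₂ * CliffordAlgebra.reverse B) →
      ∃ a b : Fin r → SubspaceAngles.V n,
        SubspaceAngles.IsPrincipalSystem
          (SubspaceAngles.bladeSpace A₂) (SubspaceAngles.bladeSpace B) a b ∧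
        A * CliffordAlgebra.reverse B = A₁ * SubspaceAngles.rotorSum a b) ∧
    -- every choice of principal vectors
    ∀ a b : Fin r → SubspaceAngles.V n,
      SubspaceAngles.IsPrincipalSystem
        (SubspaceAngles.bladeSpace A₂) (SubspaceAngles.bladeSpace B) a b →
      ∀ (s t : ℕ) (X L W F : SubspaceAngles.Cl n),
        s = (SubspaceAngles.parIdx a b).card →
        t = (SubspaceAngles.perpIdx a b).card →
        X = A * CliffordAlgebra.reverse B →
        L = SubspaceAngles.gradePart (2 * t + q) X →
        W = X * Ring.inverse L →
        F = SubspaceAngles.gradePart 2 W →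
        -- `s` is the dimension of the intersection, and `t` does not depend on the factorization
        s = Module.finrank ℝ
          ↥(SubspaceAngles.bladeSpace A ⊓ SubspaceAngles.bladeSpace B) ∧
        (∀ A₁' A₂' : SubspaceAngles.Cl n, SubspaceAngles.IsFactorization q r A B A₁' A₂' →
          ∀ a' b' : Fin r → SubspaceAngles.V n,
            SubspaceAngles.IsPrincipalSystem
              (SubspaceAngles.bladeSpace A₂') (SubspaceAngles.bladeSpace B) a' b' →
            (SubspaceAngles.perpIdx a' b').card = t) ∧
        (∃ ε : ℝ, (ε = 1 ∨ ε = -1) ∧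
          -- the product formula, up to the relative orientation `ε`
          X = ε • (A₁ * SubspaceAngles.rotorSum a b) ∧
          -- the lowest non-zero grade part
          L = (ε * ∏ k ∈ SubspaceAngles.midIdx a b, Real.cos (SubspaceAngles.ang a b k)) •
            (A₁ * SubspaceAngles.planeProd a b (SubspaceAngles.perpIdx a b))) ∧
        (∀ j < 2 * t + q, SubspaceAngles.gradePart j X = 0) ∧
        L ≠ 0 ∧
        SubspaceAngles.magnitude L =
          ∏ k ∈ SubspaceAngles.midIdx a b, Real.cos (SubspaceAngles.ang a b k) ∧
        -- the highest non-zero grade part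
        (∀ j > 2 * (r - s) + q, SubspaceAngles.gradePart j X = 0) ∧
        SubspaceAngles.gradePart (2 * (r - s) + q) X ≠ 0 ∧
        SubspaceAngles.magnitude (SubspaceAngles.gradePart (2 * (r - s) + q) X) =
          ∏ k ∈ SubspaceAngles.midIdx a b, Real.sin (SubspaceAngles.ang a b k) ∧
        -- division by the lowest non-zero grade part, on either side
        IsUnit L ∧
        W = Ring.inverse L * X ∧
        (∀ j > 2 * (r - t - s), SubspaceAngles.gradePart j W = 0) ∧
        SubspaceAngles.gradePart (2 * (r - t - s)) W ≠ 0 ∧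
        SubspaceAngles.scalarPart W = 1 ∧
        F = ∑ k ∈ SubspaceAngles.midIdx a b,
          Real.tan (SubspaceAngles.ang a b k) • SubspaceAngles.planeBivector a b k ∧
        -- the principal angles are read off from any orthogonal splitting of the bivector part
        SubspaceAngles.IsSplitting F
          (fun k : ↥(SubspaceAngles.midIdx a b) => Real.tan (SubspaceAngles.ang a b k))
          (fun k : ↥(SubspaceAngles.midIdx a b) => SubspaceAngles.planeBivector a b k) ∧
        ∀ (m : ℕ) (τ : Fin m → ℝ) (J : Fin m → SubspaceAngles.Cl n),
          SubspaceAngles.IsSplitting F τ J →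
          (Finset.univ : Finset (Fin m)).val.map (fun j => Real.arctan (τ j)) =
            (SubspaceAngles.midIdx a b).val.map (SubspaceAngles.ang a b) := by
  refine ⟨SubspaceAngles.exists_isPrincipalSystem _ _ hfac.normed_right.finrank hB.finrank,
    hfac.exists_eq_rotorSum hB, ?_⟩
  rintro a b h s t X L W F hs ht hX hL hW hF
  obtain ⟨e, δ, ε, he, hδ, hε, hA₁, hea, heb, hX₁, hX₂⟩ := hfac.exists_expansion hB h
  rw [← hX] at hX₁ hX₂
  have hY := h.isBladeFamily he hea heb subset_rfl
  have hεδ := SubspaceAngles.abs_eq_one_of_eq_one_or_neg_one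
    (SubspaceAngles.mul_eq_one_or_neg_one hε hδ)
  have hεδ0 := SubspaceAngles.ne_zero_of_eq_one_or_neg_one
    (SubspaceAngles.mul_eq_one_or_neg_one hε hδ)
  have hcos := SubspaceAngles.prod_cos_pos a b
  have hsin := h.prod_sin_pos
  have hcard := h.card_add
  rw [← hs, ← ht] at hcard
  rw [← ht] at hY
  have hlow : L = (ε * δ * ∏ k ∈ SubspaceAngles.midIdx a b, Real.cos (SubspaceAngles.ang a b k)) •
      (SubspaceAngles.vecProd (List.ofFn e) * SubspaceAngles.planeProd a b ∅ *
        SubspaceAngles.planeProd a b (SubspaceAngles.perpIdx a b)) := by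
    rw [hL, hX₂, hY.gradePart_lowest]
    simp
  have hL₁ : L = (ε * ∏ k ∈ SubspaceAngles.midIdx a b, Real.cos (SubspaceAngles.ang a b k)) •
      (A₁ * SubspaceAngles.planeProd a b (SubspaceAngles.perpIdx a b)) := by
    rw [hlow, hA₁, SubspaceAngles.planeProd_empty, mul_one, smul_mul_assoc, smul_smul]
    congr 1
    ring
  -- `Z`, `M`, `P` partition the `r` indices, so the natural subtraction does not truncate.
  have htop : 2 * (r - s) + q = 2 * t + q + 2 * (SubspaceAngles.midIdx a b).card := by omega
  have hhigh : SubspaceAngles.gradePart (2 * (r - s) + q) X =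
      (ε * δ * ∏ k ∈ SubspaceAngles.midIdx a b, Real.sin (SubspaceAngles.ang a b k)) •
      (SubspaceAngles.vecProd (List.ofFn e) *
        SubspaceAngles.planeProd a b (SubspaceAngles.midIdx a b) *
        SubspaceAngles.planeProd a b (SubspaceAngles.perpIdx a b)) := by
    rw [htop, hX₂, hY.gradePart_highest]
    simp
  have hLunit : IsUnit L := by
    rw [hlow]
    exact (hY.isUnit (Finset.empty_subset _)).smul (Units.mk0 _ (mul_ne_zero hεδ0 hcos.ne'))
  let R : SubspaceAngles.Cl n := ∑ S ∈ (SubspaceAngles.midIdx a b).powerset,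
    (∏ k ∈ S, Real.tan (SubspaceAngles.ang a b k)) • SubspaceAngles.planeProd a b S
  have hRdef : R = ∑ S ∈ (SubspaceAngles.midIdx a b).powerset,
    (∏ k ∈ S, Real.tan (SubspaceAngles.ang a b k)) • SubspaceAngles.planeProd a b S := rfl
  -- The vectors of `A₁` are orthogonal to every principal plane, so they commute with each `𝐢ₖ`.
  -- Together with `hRP` this makes the left and right quotients by `L` agree.
  have hRA : Commute R A₁ := by
    rw [hA₁]
    refine Commute.smul_right (Commute.sum_left _ _ _ fun S _ => Commute.smul_left
      (SubspaceAngles.planeProd_commute_vecProd ?_ ?_ S) _) _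
    · intro x hx k
      obtain ⟨i, rfl⟩ := (List.mem_ofFn' _ _).mp hx
      exact hea i k
    · intro x hx k
      obtain ⟨i, rfl⟩ := (List.mem_ofFn' _ _).mp hx
      exact heb i k
  have hRP : Commute R (SubspaceAngles.planeProd a b (SubspaceAngles.perpIdx a b)) :=
    Commute.sum_left _ _ _ fun S _ => Commute.smul_left (h.planeProd_commute _ _) _
  have hRL : Commute R L := by
    rw [hL₁]
    exact Commute.smul_right (hRA.mul_right hRP) _
  have hXL : X = L * R := by
    rw [hX₁, hL₁, SubspaceAngles.rotorSum_eq_tan, smul_mul_assoc, mul_assoc, ← hRP.eq,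
      mul_smul_comm, smul_smul]
  have hWR : W = R := by
    rw [hW, hXL, ← hRL.eq, Ring.mul_inverse_cancel_right _ _ hLunit]
  have hYW := h.isBladeFamily_planeProd
  have htan : 0 < ∏ k ∈ SubspaceAngles.midIdx a b, Real.tan (SubspaceAngles.ang a b k) :=
    Finset.prod_pos fun _ hk => SubspaceAngles.tan_ang_pos hk
  have htopW : 2 * (r - t - s) = 0 + 2 * (SubspaceAngles.midIdx a b).card := by omega
  have hFsum : F = ∑ k ∈ SubspaceAngles.midIdx a b,
      Real.tan (SubspaceAngles.ang a b k) • SubspaceAngles.planeBivector a b k := by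
    rw [hF, hWR, hRdef, hYW.gradePart_two]
    simp only [Finset.prod_singleton, SubspaceAngles.planeProd_singleton]
  refine ⟨hs.trans (hfac.card_parIdx_eq hB h), fun A₁' A₂' hfac' a' b' h' =>
    (hfac.card_perpIdx_eq hfac' hB h h').trans ht.symm, ⟨ε, hε, hX₁, hL₁⟩, ?_, hLunit.ne_zero, ?_,
    ?_, ?_, ?_, hLunit, ?_, ?_, ?_, ?_, hFsum, ?_, ?_⟩
  · intro j hj
    rw [hX₂]
    exact hY.gradePart_of_lt _ hj
  · rw [hlow, hY.magnitude_smul (Finset.empty_subset _), abs_mul, hεδ, one_mul, abs_of_pos hcos]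
  · intro j hj
    rw [hX₂]
    exact hY.gradePart_of_gt _ (htop ▸ hj)
  · rw [hhigh]
    exact smul_ne_zero (mul_ne_zero hεδ0 hsin.ne') (hY.isUnit subset_rfl).ne_zero
  · rw [hhigh, hY.magnitude_smul subset_rfl, abs_mul, hεδ, one_mul, abs_of_pos hsin]
  · rw [hWR, hXL, Ring.inverse_mul_cancel_left _ _ hLunit]
  · intro j hj
    rw [hWR]
    exact hYW.gradePart_of_gt _ (htopW ▸ hj)
  · rw [hWR, htopW, hRdef, hYW.gradePart_highest]
    exact smul_ne_zero htan.ne' (hYW.isUnit subset_rfl).ne_zero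
  · rw [hWR, hRdef, hYW.scalarPart_sum, Finset.prod_empty]
  · rw [hFsum]
    exact h.isSplitting
  · intro m τ J hJ
    rw [hFsum] at hJ
    exact h.map_arctan_eq hJ
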